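/- Let $\mathbb K\in\{\mathbb R,\mathbb C\}$ and consider the constant coefficient first order system $\sum_{a}\mathfrak N^{a}\partial_a\phi=0$ in space-time dimension $d+1$, with $\mathfrak N^{a}\in\mathbb K^{e\times u}$ ($u$ fields, $e$ equations). For a covector $l\in\mathbb C^{d+1}$ let $\mathfrak N(l)=\sum_a l_a\mathfrak N^a\in\mathbb C^{e\times u}$ be the principal symbol. Let $n\in\mathbb R^{d+1}$ and suppose that the system is hyperbolic with respect to $n$: $\mathfrak N(n)$ has trivial right kernel, and, for every $k\in\mathbb R^{d+1}$ not proportional to $n$ and every $\lambda\in\mathbb C$, if $\mathfrak N(-\lambda n+k)$ has a nontrivial right kernel then $\lambda\in\mathbb R$. Fix positive definite Hermitian forms $G_\Psi$ on $\mathbb C^e$ and $G_\Phi$ on $\mathbb C^u$; all singular values of maps $\mathbb C^u\to\mathbb C^e$ are taken with respect to them. A reduction is a map $h$ assigning to covectors $k$ matrices $h(k)\in\mathbb K^{u\times e}$ such that, for all $k$ not proportional to $n$, $h(k)\mathfrak N(n)$ is invertible and $h(ck)=h(k)$ for all real $c\neq0$ (homogeneity of degree $0$). Put $A(k)=(h(k)\mathfrak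 N(n))^{-1}h(k)\mathfrak N(k)$. For each line $l(\lambda)=-\lambda n+k$, with $k$ real and not proportional to $n$, the following conditions are equivalent. (i) There is a reduction $h$ such that $A(k)$ is diagonalizable (over $\mathbb C$). (i$'$) There is a reduction $h$ such that $A(k)$ is Hermitizable: there is a positive definite Hermitian form $H$ over $\mathbb K$ with $HA(k)$ Hermitian. In particular $A(k)$ is diagonalizable over $\mathbb K$ with real eigenvalues. (ii) The Kronecker decomposition of the matrix pencil $\lambda(-\mathfrak N(n))+\mathfrak N(k)$ over $\mathbb C$ has only Jordan blocks of size $1\times1$, that is, it consists only of $1\times 1$ blocks $(\lambda-\mu)$ and of blocks $L_m^T$, $m\ge0$ (the $(m+1)\times m$ matrix with $\lambda$ on the diagonal and $1$ just below it). That is, such a decomposition exists and every Kronecker decomposition of the pencil is of this kind. (iii) Along the extended lines $l_{\varepsilon,\theta}(\lambda)=-\varepsilon e^{i\theta}n-\lambda n+k$ ($\lambda\in\mathbb R$, $\theta\in[0,2\pi]$), each of the $u$ singular values $\sigma_j(\varepsilon)$ of $\mathfrak N(l_{\varepsilon,\theta}(\lambda))$ is of exact order $|\varepsilon|^0$ or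 $|\varepsilon|^1$ as $\varepsilon\to0$, $\varepsilon\in\mathbb R\setminus\{0\}$, that is, $\sigma_j(\varepsilon)=\Theta(1)$ or $\sigma_j(\varepsilon)=\Theta(|\varepsilon|)$. (iii$'$) For each real $\lambda$, let $r$ be the dimension of the right kernel of $\mathfrak N(-\lambda n+k)$, let $Q$ be a matrix whose columns are a $G_\Phi$-orthonormal basis of this kernel, and let $X$ be a matrix whose rows are a basis of the left kernel, orthonormal for the form induced by $G_\Psi$ on covectors. Then the $r$ singular values $\rho_1,\dots,\rho_r$ of the matrix $R=X\,\mathfrak N(n)\,Q$ (with respect to the standard inner products) are positive, for every choice of these bases. Moreover the corresponding conditions for all lines together are equivalent: there is one reduction $h$ such that $A(k)$ is diagonalizable for all $k$ not proportional to $n$; there is one reduction $h$ such that $A(k)$ is Hermitizable for all such $k$; (ii) holds for all such $k$; (iii) holds for all such $k$; (iii$'$) holds for all such $k$. -/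

import Mathlib

open scoped ComplexOrder

namespace FirstOrderSystem

/-! Constant coefficient systems `∑ a, 𝔑 a * ∂ₐ φ = 0` with `e` equations for `u` fields in
space-time dimension `d + 1`. The coefficients are real or complex (`𝕜 = ℝ` or `𝕜 = ℂ`). -/

section Symbol

variable {𝕜 : Type*} [RCLike 𝕜] {d e u : ℕ}

/-- The principal symbol at a real covector `l`. -/
noncomputable def symbol (𝔑 : Fin (d + 1) → Matrix (Fin e) (Fin u) 𝕜) (l : Fin (d + 1) → ℝ) :
    Matrix (Fin e) (Fin u) 𝕜 :=
  ∑ a, l a • 𝔑 a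

/-- The principal symbol at a complex covector `l`, acting on the complexified fields. -/
noncomputable def complexSymbol (𝔑 : Fin (d + 1) → Matrix (Fin e) (Fin u) 𝕜) (l : Fin (d + 1) → ℂ) :
    Matrix (Fin e) (Fin u) ℂ :=
  ∑ a, l a • (𝔑 a).map (RCLike.map 𝕜 ℂ)

/-- The covector `l(z) = -z n + k`. -/
noncomputable def line (n k : Fin (d + 1) → ℝ) (z : ℂ) : Fin (d + 1) → ℂ :=
  fun a => -z * (n a : ℂ) + (k a : ℂ)

/-- The covector `l_{ε,θ}(z) = -ε e^{iθ} n + l(z)` on the extended line. -/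
noncomputable def extendedLine (n k : Fin (d + 1) → ℝ) (z : ℂ) (ε θ : ℝ) : Fin (d + 1) → ℂ :=
  fun a => -((ε : ℂ) * Complex.exp (Complex.I * θ)) * (n a : ℂ) + line n k z a

/-- The covector `k` is not proportional to `n`. -/
def Transverse (n k : Fin (d + 1) → ℝ) : Prop := k ∉ Submodule.span ℝ {n}

/-- Hyperbolicity with respect to `n`: the symbol at `n` has no right kernel, and on the planes
`-z n + k` it has a right kernel only at real `z`. -/
structure IsHyperbolic (𝔑 : Fin (d + 1) → Matrix (Fin e) (Fin u) 𝕜) (n : Fin (d + 1) → ℝ) :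
    Prop where
  ker_eq_bot : ∀ φ : Fin u → ℂ,
    (complexSymbol 𝔑 (fun a => (n a : ℂ))).mulVec φ = 0 → φ = 0
  real_of_ker : ∀ k, Transverse n k → ∀ z : ℂ,
    (∃ φ : Fin u → ℂ, φ ≠ 0 ∧ (complexSymbol 𝔑 (line n k z)).mulVec φ = 0) → z.im = 0

end Symbol

section Reduction

variable {𝕜 : Type*} [RCLike 𝕜] {d e u : ℕ}

/-- A reduction, homogeneous of degree `0` in the covector `k`. -/
structure IsReduction (𝔑 : Fin (d + 1) → Matrix (Fin e) (Fin u) 𝕜) (n : Fin (d + 1) → ℝ)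
    (h : (Fin (d + 1) → ℝ) → Matrix (Fin u) (Fin e) 𝕜) : Prop where
  isUnit : ∀ k, Transverse n k → IsUnit (h k * symbol 𝔑 n)
  homogeneous : ∀ k, Transverse n k → ∀ c : ℝ, c ≠ 0 → h (c • k) = h k

/-- The reduced matrix `A(k) = (h 𝔑(n))⁻¹ h 𝔑(k)`. -/
noncomputable def reducedMatrix (𝔑 : Fin (d + 1) → Matrix (Fin e) (Fin u) 𝕜)
    (n : Fin (d + 1) → ℝ) (h : (Fin (d + 1) → ℝ) → Matrix (Fin u) (Fin e) 𝕜)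
    (k : Fin (d + 1) → ℝ) : Matrix (Fin u) (Fin u) 𝕜 :=
  (h k * symbol 𝔑 n)⁻¹ * (h k * symbol 𝔑 k)

/-- `A` is diagonalizable over `ℂ`. -/
def Diagonalizable (A : Matrix (Fin u) (Fin u) 𝕜) : Prop :=
  ∃ (S : Matrix (Fin u) (Fin u) ℂ) (D : Fin u → ℂ),
    IsUnit S ∧ A.map (RCLike.map 𝕜 ℂ) = S * Matrix.diagonal D * S⁻¹

/-- There is a positive definite Hermitian form `H` over `𝕜` for which `H A` is Hermitian; in
particular `A` is diagonalizable over `𝕜` with real eigenvalues. -/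
def Hermitizable (A : Matrix (Fin u) (Fin u) 𝕜) : Prop :=
  ∃ H : Matrix (Fin u) (Fin u) 𝕜, H.PosDef ∧ (H * A).IsHermitian

end Reduction

section Kronecker

/-- The blocks of Kronecker's canonical form of a matrix pencil. Zero rows are the blocks
`LT 0` and zero columns are the blocks `L 0`. -/
inductive KroneckerBlock : Type
  /-- the `m × m` Jordan block with eigenvalue `μ` -/
  | jordan (μ : ℂ) (m : ℕ) (hm : 1 ≤ m)
  /-- the `m × m` block of an infinite elementary divisor -/
  | infinite (m : ℕ) (hm : 1 ≤ m)
  /-- the `m × (m + 1)` block -/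
  | L (m : ℕ)
  /-- the `(m + 1) × m` block -/
  | LT (m : ℕ)

namespace KroneckerBlock

/-- Number of rows. -/
def rows : KroneckerBlock → ℕ
  | jordan _ m _ => m
  | infinite m _ => m
  | L m => m
  | LT m => m + 1

/-- Number of columns. -/
def cols : KroneckerBlock → ℕ
  | jordan _ m _ => m
  | infinite m _ => m
  | L m => m + 1
  | LT m => m

/-- The entries of the block, as polynomial functions of the pencil parameter `z`:
`jordan` has `z - μ` on the diagonal and `1` just above it, `infinite` has `1` on the diagonal and
`z` just above it, `L` has `z` on the diagonal and `1` just above it, `LT` has `z` on the diagonal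
and `1` just below it. -/
def entry (z : ℂ) : KroneckerBlock → ℕ → ℕ → ℂ
  | jordan μ _ _, i, j => if i = j then z - μ else if j = i + 1 then 1 else 0
  | infinite _ _, i, j => if i = j then 1 else if j = i + 1 then z else 0
  | L _, i, j => if i = j then z else if j = i + 1 then 1 else 0
  | LT _, i, j => if i = j then z else if i = j + 1 then 1 else 0

/-- The block at parameter `z`. -/
def pencil (B : KroneckerBlock) (z : ℂ) : Matrix (Fin B.rows) (Fin B.cols) ℂ :=
  Matrix.of fun i j => B.entry z i j

/-- The block is a `1 × 1` Jordan block or an `LT` block. -/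
def IsTrivial : KroneckerBlock → Prop
  | jordan _ m _ => m = 1
  | infinite _ _ => False
  | L _ => False
  | LT _ => True

end KroneckerBlock

/-- The blocks `B 0, …, B (b - 1)` form a Kronecker decomposition `P(z) = Y K(z) W` of the matrix
pencil `P`, where `Y`, `W` are invertible and do not depend on `z` and `K(z)` is the block diagonal
matrix with these blocks. -/
def IsKroneckerDecomposition {e u b : ℕ} (P : ℂ → Matrix (Fin e) (Fin u) ℂ)
    (B : Fin b → KroneckerBlock) : Prop :=
  ∃ (er : (Σ i, Fin (B i).rows) ≃ Fin e) (ec : (Σ i, Fin (B i).cols) ≃ Fin u)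
    (Y : Matrix (Fin e) (Fin e) ℂ) (W : Matrix (Fin u) (Fin u) ℂ),
    IsUnit Y ∧ IsUnit W ∧
      ∀ z, P z = Y * (Matrix.blockDiagonal' fun i => (B i).pencil z).reindex er ec * W

/-- The Kronecker decomposition of the pencil `P` consists of `1 × 1` Jordan blocks and `LT` blocks:
there is such a decomposition, and every Kronecker decomposition is of this kind. -/
def TrivialKronecker {e u : ℕ} (P : ℂ → Matrix (Fin e) (Fin u) ℂ) : Prop :=
  (∃ (b : ℕ) (B : Fin b → KroneckerBlock),
    IsKroneckerDecomposition P B ∧ ∀ i, (B i).IsTrivial) ∧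
  ∀ (b : ℕ) (B : Fin b → KroneckerBlock),
    IsKroneckerDecomposition P B → ∀ i, (B i).IsTrivial

end Kronecker

section SingularValues

variable {𝕜 : Type*} [RCLike 𝕜] {d e u : ℕ}

/-- The space `ℂᵐ` with the inner product `⟨x, y⟩ = xᴴ G y` given by a positive definite Hermitian
form `G`. -/
def FormSpace {m : ℕ} {G : Matrix (Fin m) (Fin m) ℂ} (_hG : G.PosDef) : Type := Fin m → ℂ

noncomputable instance {m : ℕ} {G : Matrix (Fin m) (Fin m) ℂ} (hG : G.PosDef) :
    NormedAddCommGroup (FormSpace hG) :=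
  G.toNormedAddCommGroup hG

noncomputable instance {m : ℕ} {G : Matrix (Fin m) (Fin m) ℂ} (hG : G.PosDef) :
    InnerProductSpace ℂ (FormSpace hG) :=
  G.toInnerProductSpace hG.posSemidef

instance {m : ℕ} {G : Matrix (Fin m) (Fin m) ℂ} (hG : G.PosDef) :
    FiniteDimensional ℂ (FormSpace hG) :=
  inferInstanceAs (FiniteDimensional ℂ (Fin m → ℂ))

/-- The linear map `x ↦ M x` between the spaces with inner products `GΦ` and `GΨ`. -/
noncomputable def formMap {GΨ : Matrix (Fin e) (Fin e) ℂ} (hΨ : GΨ.PosDef)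
    {GΦ : Matrix (Fin u) (Fin u) ℂ} (hΦ : GΦ.PosDef) (M : Matrix (Fin e) (Fin u) ℂ) :
    FormSpace hΦ →ₗ[ℂ] FormSpace hΨ where
  toFun := M.mulVec
  map_add' := M.mulVec_add
  map_smul' c x := M.mulVec_smul c x

/-- The singular values of `M : ℂᵘ → ℂᵉ`, in decreasing order, with respect to the inner products
given by `GΦ` on `ℂᵘ` and `GΨ` on `ℂᵉ`. -/
noncomputable def singularValues {GΨ : Matrix (Fin e) (Fin e) ℂ} (hΨ : GΨ.PosDef)
    {GΦ : Matrix (Fin u) (Fin u) ℂ} (hΦ : GΦ.PosDef) (M : Matrix (Fin e) (Fin u) ℂ) : ℕ →₀ ℝ :=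
  (formMap hΨ hΦ M).singularValues

/-- Along the extended lines through the real line `-z n + k`, each of the `u` singular values of
the symbol is of exact order `|ε|⁰` or `|ε|¹` as `ε → 0`. -/
def SingularValuesOrderLeOne (𝔑 : Fin (d + 1) → Matrix (Fin e) (Fin u) 𝕜)
    {GΨ : Matrix (Fin e) (Fin e) ℂ} (hΨ : GΨ.PosDef)
    {GΦ : Matrix (Fin u) (Fin u) ℂ} (hΦ : GΦ.PosDef) (n k : Fin (d + 1) → ℝ) : Prop :=
  ∀ z : ℝ, ∀ θ ∈ Set.Icc 0 (2 * Real.pi), ∀ j < u, ∃ p ∈ ({0, 1} : Set ℕ),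
    Asymptotics.IsTheta (nhdsWithin (0 : ℝ) {0}ᶜ)
      (fun ε => singularValues hΨ hΦ (complexSymbol 𝔑 (extendedLine n k z ε θ)) j)
      (fun ε => |ε| ^ p)

/-- The columns of `Q` are a basis of the right kernel of `M`, orthonormal with respect to `G`. -/
structure IsRightKernelBasis {r : ℕ} (M : Matrix (Fin e) (Fin u) ℂ)
    (G : Matrix (Fin u) (Fin u) ℂ) (Q : Matrix (Fin u) (Fin r) ℂ) : Prop where
  mul_eq_zero : M * Q = 0
  orthonormal : Q.conjTranspose * G * Q = 1
  spans : ∀ φ : Fin u → ℂ, M.mulVec φ = 0 → ∃ c : Fin r → ℂ, φ = Q.mulVec c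

/-- The rows of `X` are a basis of the left kernel of `M`, a space of covectors, orthonormal with
respect to the inverse `G⁻¹` of the metric `G`. -/
structure IsLeftKernelBasis {q : ℕ} (M : Matrix (Fin e) (Fin u) ℂ)
    (G : Matrix (Fin e) (Fin e) ℂ) (X : Matrix (Fin q) (Fin e) ℂ) : Prop where
  mul_eq_zero : X * M = 0
  orthonormal : X * G⁻¹ * X.conjTranspose = 1
  spans : ∀ x : Fin e → ℂ, M.vecMul x = 0 → ∃ c : Fin q → ℂ, x = X.vecMul c

/-- At each real `z`, the `r` singular values `ρ_j` of the matrix `R = X 𝔑(n) Q` are positive,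
where `X` and `Q` are orthonormal bases of the left and of the right kernel of `𝔑(-z n + k)` and
`r` is the dimension of the right kernel (`r = 0` unless `z` is a generalized eigenvalue). -/
def PerturbationCoefficientsPos (𝔑 : Fin (d + 1) → Matrix (Fin e) (Fin u) 𝕜)
    (GΨ : Matrix (Fin e) (Fin e) ℂ) (GΦ : Matrix (Fin u) (Fin u) ℂ)
    (n k : Fin (d + 1) → ℝ) : Prop :=
  ∀ (z : ℝ) (q r : ℕ) (X : Matrix (Fin q) (Fin e) ℂ) (Q : Matrix (Fin u) (Fin r) ℂ),
    IsLeftKernelBasis (complexSymbol 𝔑 (line n k z)) GΨ X →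
    IsRightKernelBasis (complexSymbol 𝔑 (line n k z)) GΦ Q →
    ∀ j < r, 0 < (Matrix.toEuclideanLin
      (X * complexSymbol 𝔑 (fun a => (n a : ℂ)) * Q)).singularValues j

end SingularValues

end FirstOrderSystem

/-! Write N for the symbol at `n` and K for the symbol at `k`, so that the line carries the pencil K
- zN. Every condition is compared with a single one, `HasNoChain`: no φ ≠ 0 satisfies (K - zN)φ = 0
and Nφ = (K - zN)ψ. In other words, the pencil has no Jordan chain of length two.

The hard direction is from `HasNoChain` to a Hermitizable reduction. It suffices that the covectors
xN, with x(K - μN) = 0 and μ real, span the dual of field space (`span_leftKernel_eq_top`): a basis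
of them, written as the rows of M N, makes M K = diag(μ) M N. If they did not span, some φ ≠ 0 would
be annihilated by all of them, and by duality Nφ would lie in the range of K - μN for every real μ.
Cramer's rule turns these solutions into a polynomial solution of (K - zN)ψ(z) = q(z)Nφ. Each root
of q can be divided out: the value of ψ there is an eigenvector, hence zero, since otherwise
hyperbolicity makes the root real and a Jordan chain appears. Once q is constant, comparing
coefficients gives φ = 0. Everything happens over 𝕜 because the μ are real.

For the Kronecker form, bases made of chains are built by induction on the dimension, passing from
(N, K) to the inclusion and N⁻¹K on the subspace K⁻¹(range N) (`hasChainBases`). For the singular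
values, the condition amounts to a lower bound c|ε| for the perturbed symbol: a diagonalizing
reduction supplies it, and a Jordan chain violates it. Positivity of the ρ_j says that N maps no
nonzero vector of the kernel of K - zN into its range, which is `HasNoChain` at real z; other z have
no kernel. -/

namespace FirstOrderSystem

section

open Matrix Polynomial

/-! ### Passing from 𝕜 to ℂ. -/

section Complexification

variable {𝕜 : Type*} [RCLike 𝕜]

/-- The canonical map into `ℂ` as a ring homomorphism. -/
noncomputable def complexHom (𝕜 : Type*) [RCLike 𝕜] : 𝕜 →+* ℂ where
  toFun := RCLike.map 𝕜 ℂ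
  map_one' := by simp
  map_zero' := map_zero _
  map_add' := map_add _
  map_mul' x y := by
    apply Complex.ext <;> simp

theorem coe_complexHom : ⇑(complexHom 𝕜) = RCLike.map 𝕜 ℂ := rfl

theorem complexHom_ofReal (x : ℝ) : complexHom 𝕜 (x : 𝕜) = x := by
  apply Complex.ext <;> simp [coe_complexHom]

theorem map_complexHom_mul {l m n : Type*} [Fintype m] (A : Matrix l m 𝕜) (B : Matrix m n 𝕜) :
    (A * B).map (complexHom 𝕜) = A.map (complexHom 𝕜) * B.map (complexHom 𝕜) :=
  Matrix.map_mul

theorem map_complexHom_inv {n : Type*} [Fintype n] [DecidableEq n] {A : Matrix n n 𝕜}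
    (hA : IsUnit A) : A⁻¹.map (complexHom 𝕜) = (A.map (complexHom 𝕜))⁻¹ := by
  symm
  apply Matrix.inv_eq_left_inv
  rw [← map_complexHom_mul, Matrix.nonsing_inv_mul _ ((Matrix.isUnit_iff_isUnit_det _).1 hA),
    Matrix.map_one _ (map_zero _) (map_one _)]

end Complexification

/-! ### Absence of Jordan chains, the condition common to all others. -/

section NoChain

variable {m n : Type*} [Fintype n]

/-- The pencil `K - z N` has no Jordan chain of length two. -/
def HasNoChain (N K : Matrix m n ℂ) : Prop :=
  ∀ (z : ℂ) (φ ψ : n → ℂ), K *ᵥ φ = z • N *ᵥ φ → N *ᵥ φ = K *ᵥ ψ - z • N *ᵥ ψ → φ = 0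

/-- After applying S⁻¹ L the chain equations decouple into (D i - z) φ_i = 0 and φ_i = (D i - z)
ψ_i, which force every φ_i to vanish. -/
theorem HasNoChain.of_diagonal [Fintype m] [DecidableEq n] {N K : Matrix m n ℂ} {L : Matrix n m ℂ}
    (hL : L * N = 1) {S : Matrix n n ℂ} {D : n → ℂ} (hS : IsUnit S)
    (hA : L * K = S * diagonal D * S⁻¹) : HasNoChain N K := by
  have hS' : S⁻¹ * S = 1 := Matrix.nonsing_inv_mul _ ((Matrix.isUnit_iff_isUnit_det _).1 hS)
  have hS2 : S * S⁻¹ = 1 := Matrix.mul_nonsing_inv _ ((Matrix.isUnit_iff_isUnit_det _).1 hS)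
  have hSL : ∀ x, S⁻¹ *ᵥ L *ᵥ N *ᵥ x = S⁻¹ *ᵥ x := fun x => by
    rw [Matrix.mulVec_mulVec x L N, hL, Matrix.one_mulVec]
  have hSK : ∀ x, S⁻¹ *ᵥ L *ᵥ K *ᵥ x = diagonal D *ᵥ S⁻¹ *ᵥ x := fun x => by
    rw [Matrix.mulVec_mulVec x L K, hA, Matrix.mulVec_mulVec, ← Matrix.mul_assoc,
      ← Matrix.mul_assoc, hS', Matrix.one_mul, ← Matrix.mulVec_mulVec]
  intro z φ ψ h1 h2
  have h1 := congrArg (fun x => S⁻¹ *ᵥ L *ᵥ x) h1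
  have h2 := congrArg (fun x => S⁻¹ *ᵥ L *ᵥ x) h2
  simp only [Matrix.mulVec_smul, Matrix.mulVec_sub, hSL, hSK] at h1 h2
  have h3 : S⁻¹ *ᵥ φ = 0 := by
    funext i
    have a := congrFun h1 i
    have b := congrFun h2 i
    simp only [Matrix.mulVec_diagonal, Pi.smul_apply, smul_eq_mul, Pi.sub_apply] at a b
    rw [Pi.zero_apply]
    have : (D i - z) * (S⁻¹ *ᵥ φ) i = 0 := by linear_combination a
    rcases mul_eq_zero.1 this with h | h
    · rw [b]; linear_combination h * (S⁻¹ *ᵥ ψ) i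
    · exact h
  calc φ = S *ᵥ S⁻¹ *ᵥ φ := by rw [Matrix.mulVec_mulVec, hS2, Matrix.one_mulVec]
    _ = 0 := by rw [h3, Matrix.mulVec_zero]

end NoChain

/-! ### Hermitizable matrices are diagonalizable. -/

section Hermitizable

variable {𝕜 : Type*} [RCLike 𝕜] {u : ℕ}

/-- A matrix `B` with `B` invertible and `H = Bᴴ B`. -/
theorem exists_isUnit_conjTranspose_mul_self {H : Matrix (Fin u) (Fin u) 𝕜} (hH : H.PosDef) :
    ∃ B : Matrix (Fin u) (Fin u) 𝕜, IsUnit B ∧ H = Bᴴ * B := by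
  open scoped MatrixOrder in
  obtain ⟨B, hB⟩ := CStarAlgebra.nonneg_iff_eq_star_mul_self.1
    (Matrix.nonneg_iff_posSemidef.2 hH.posSemidef)
  refine ⟨B, ?_, hB⟩
  have := hH.isUnit
  rw [hB, Matrix.isUnit_iff_isUnit_det, Matrix.det_mul] at this
  exact (Matrix.isUnit_iff_isUnit_det _).2 (isUnit_of_mul_isUnit_right this)

/-- With H = Bᴴ B, the matrix B A B⁻¹ is Hermitian in the standard sense, and the spectral theorem
applies to it. -/
theorem Hermitizable.diagonalizable {A : Matrix (Fin u) (Fin u) 𝕜} (hA : Hermitizable A) :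
    Diagonalizable A := by
  obtain ⟨H, hH, hHA⟩ := hA
  obtain ⟨B, hB, rfl⟩ := exists_isUnit_conjTranspose_mul_self hH
  have hBd := (Matrix.isUnit_iff_isUnit_det _).1 hB
  have hB1 : B⁻¹ * B = 1 := Matrix.nonsing_inv_mul _ hBd
  have hB2 : B * B⁻¹ = 1 := Matrix.mul_nonsing_inv _ hBd
  have hT : (B * A * B⁻¹).IsHermitian := by
    have := Matrix.isHermitian_conjTranspose_mul_mul B⁻¹ hHA
    have h2 : (B⁻¹)ᴴ * Bᴴ = 1 := by rw [← Matrix.conjTranspose_mul, hB2, Matrix.conjTranspose_one]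
    convert this using 1
    calc B * A * B⁻¹ = ((B⁻¹)ᴴ * Bᴴ) * (B * A * B⁻¹) := by rw [h2, Matrix.one_mul]
      _ = _ := by simp only [Matrix.mul_assoc]
  have hsp := hT.spectral_theorem
  rw [Unitary.conjStarAlgAut_apply] at hsp
  set V : Matrix (Fin u) (Fin u) 𝕜 := hT.eigenvectorUnitary.1 with hV
  have hV1 : V * star V = 1 := Unitary.coe_mul_star_self _
  have hVu : IsUnit V := IsUnit.of_mul_eq_one _ hV1
  have hVi : V⁻¹ = star V := Matrix.inv_eq_right_inv hV1
  have hS : IsUnit (B⁻¹ * V) := (Matrix.isUnit_nonsing_inv_iff.2 hB).mul hVu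
  refine ⟨(B⁻¹ * V).map (complexHom 𝕜),
    fun i => complexHom 𝕜 (hT.eigenvalues i : 𝕜), ?_, ?_⟩
  · exact hS.map (complexHom 𝕜).mapMatrix
  · rw [← map_complexHom_inv hS]
    have hd : diagonal (fun i => complexHom 𝕜 (hT.eigenvalues i : 𝕜)) =
        (diagonal (RCLike.ofReal ∘ hT.eigenvalues : Fin u → 𝕜)).map (complexHom 𝕜) := by
      rw [Matrix.diagonal_map (map_zero _)]; rfl
    rw [hd, ← map_complexHom_mul, ← map_complexHom_mul, ← coe_complexHom]
    congr 1
    rw [Matrix.mul_inv_rev, Matrix.nonsing_inv_nonsing_inv _ hBd, hVi]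
    calc A = (B⁻¹ * B) * A * (B⁻¹ * B) := by rw [hB1]; simp
      _ = B⁻¹ * (B * A * B⁻¹) * B := by simp only [Matrix.mul_assoc]
      _ = B⁻¹ * (V * diagonal (RCLike.ofReal ∘ hT.eigenvalues) * star V) * B :=
        congrArg (fun T => B⁻¹ * T * B) hsp
      _ = _ := by simp only [Matrix.mul_assoc]

end Hermitizable

end

section

open Matrix Polynomial

/-! ### Solvability of linear systems and left inverses. -/

section LinearAlgebra

variable {𝕜 : Type*} [Field 𝕜] {m n : Type*} [Fintype m] [Fintype n]

/-- Fredholm alternative: a vector outside the range is separated from it by a functional, whose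
coordinates form a left null vector. -/
theorem exists_mulVec_eq_of_forall_vecMul_eq_zero (M : Matrix m n 𝕜) (y : m → 𝕜)
    (h : ∀ x, x ᵥ* M = 0 → x ⬝ᵥ y = 0) : ∃ ψ, M *ᵥ ψ = y := by
  classical
  by_contra hy
  have hy : y ∉ LinearMap.range M.mulVecLin := fun ⟨ψ, hψ⟩ => hy ⟨ψ, hψ⟩
  obtain ⟨f, hfy, hf⟩ := Submodule.exists_le_ker_of_notMem hy
  have hfx : ∀ v, f v = (fun i => f (Pi.single i 1)) ⬝ᵥ v := fun v => by
    conv_lhs => rw [pi_eq_sum_univ' v]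
    simp [dotProduct, mul_comm]
  apply hfy
  rw [hfx]
  apply h
  funext j
  have := hf ⟨Pi.single j 1, rfl⟩
  rw [LinearMap.mem_ker, hfx] at this
  rw [Matrix.mulVecLin_apply, Matrix.dotProduct_mulVec] at this
  simpa using this

theorem exists_leftInverse_of_mulVec_injective [DecidableEq n] (N : Matrix m n 𝕜)
    (hN : ∀ φ, N *ᵥ φ = 0 → φ = 0) : ∃ L : Matrix n m 𝕜, L * N = 1 := by
  classical
  obtain ⟨g, hg⟩ := N.mulVecLin.exists_leftInverse_of_injective
    (LinearMap.ker_eq_bot'.2 fun φ h => hN φ h)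
  refine ⟨LinearMap.toMatrix' g, ?_⟩
  have := congrArg LinearMap.toMatrix' hg
  rwa [LinearMap.toMatrix'_comp, LinearMap.toMatrix'_id, ← Matrix.toLin'_apply',
    LinearMap.toMatrix'_toLin'] at this

end LinearAlgebra

/-! ### Solving the pencil equation with polynomials in the parameter. -/

section Polynomial

variable {m n : Type*} [Fintype n]

theorem eval_mulVec_map_C (M : Matrix m n ℂ) (ψ : n → ℂ[X]) (z : ℂ) (i : m) :
    ((M.map C *ᵥ ψ) i).eval z = (M *ᵥ fun j => (ψ j).eval z) i := by
  simp [Matrix.mulVec, dotProduct, Polynomial.eval_finsetSum]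

theorem coeff_mulVec_map_C (M : Matrix m n ℂ) (ψ : n → ℂ[X]) (k : ℕ) (i : m) :
    ((M.map C *ᵥ ψ) i).coeff k = (M *ᵥ fun j => (ψ j).coeff k) i := by
  simp [Matrix.mulVec, dotProduct]

/-- A solution `ψ` of `(K - z N) ψ(z) = q(z) N φ` with a polynomial denominator `q`. -/
theorem exists_polynomial_solution [Fintype m] [DecidableEq n] {N K : Matrix m n ℂ}
    (hN : ∀ φ, N *ᵥ φ = 0 → φ = 0) {φ : n → ℂ}
    (h : ∀ μ : ℝ, ∃ ψ, N *ᵥ φ = K *ᵥ ψ - (μ : ℂ) • N *ᵥ ψ) :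
    ∃ (q : ℂ[X]) (ψ : n → ℂ[X]), q ≠ 0 ∧
      K.map C *ᵥ ψ - (X : ℂ[X]) • N.map C *ᵥ ψ = q • fun i => C ((N *ᵥ φ) i) := by
  obtain ⟨L, hL⟩ := exists_leftInverse_of_mulVec_injective N hN
  set A := L * K with hA
  -- Cramer's rule: the adjugate of μ - A applied to φ = -(μ - A)ψ gives -det(μ - A) ψ, whence the
  -- sign. The identity is checked at real μ only, which are infinitely many.
  refine ⟨A.charpoly, -(A.charmatrix.adjugate *ᵥ fun j => C (φ j)), A.charpoly_monic.ne_zero, ?_⟩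
  funext i
  apply Polynomial.eq_of_infinite_eval_eq
  refine Set.Infinite.mono ?_ (Set.infinite_range_of_injective Complex.ofReal_injective)
  rintro _ ⟨μ, rfl⟩
  obtain ⟨ψ, hψ⟩ := h μ
  have hφ : φ = -((scalar n (μ : ℂ) - A) *ᵥ ψ) := by
    have := congrArg (fun x => L *ᵥ x) hψ
    simp only [Matrix.mulVec_sub, Matrix.mulVec_smul, Matrix.mulVec_mulVec, hL, ← hA,
      Matrix.one_mulVec] at this
    rw [this, Matrix.sub_mulVec]
    simp [← Matrix.smul_one_eq_diagonal, Matrix.smul_mulVec]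
  have hmap : A.charmatrix.map (evalRingHom (μ : ℂ)) = scalar n (μ : ℂ) - A := by
    ext a b
    by_cases hab : a = b
    · subst hab; simp
    · simp [hab]
  have hev : (fun j => ((A.charmatrix.adjugate *ᵥ fun j => C (φ j)) j).eval (μ : ℂ)) =
      -(A.charpoly.eval (μ : ℂ) • ψ) := by
    have h1 : (fun j => ((A.charmatrix.adjugate *ᵥ fun j => C (φ j)) j).eval (μ : ℂ)) =
        (scalar n (μ : ℂ) - A).adjugate *ᵥ φ := by
      funext j
      have := RingHom.map_mulVec (evalRingHom (μ : ℂ)) A.charmatrix.adjugate (fun j => C (φ j)) j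
      have h2 : A.charmatrix.adjugate.map (evalRingHom (μ : ℂ)) =
          (scalar n (μ : ℂ) - A).adjugate := by
        rw [← hmap]; exact RingHom.map_adjugate (evalRingHom (μ : ℂ)) A.charmatrix
      rw [h2] at this
      simpa [Function.comp_def] using this
    rw [h1, Matrix.eval_charpoly]
    conv_lhs => rw [hφ]
    rw [Matrix.mulVec_neg, Matrix.mulVec_mulVec, Matrix.adjugate_mul, Matrix.smul_mulVec,
      Matrix.one_mulVec]
  have hev' : (fun j => ((-(A.charmatrix.adjugate *ᵥ fun j => C (φ j))) j).eval (μ : ℂ)) =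
      A.charpoly.eval (μ : ℂ) • ψ := by
    rw [← neg_neg (A.charpoly.eval (μ : ℂ) • ψ), ← hev]
    funext j; simp
  simp only [Set.mem_ofPred_eq, Pi.sub_apply, Pi.smul_apply, smul_eq_mul, Polynomial.eval_sub,
    Polynomial.eval_mul, eval_mulVec_map_C, hev', Polynomial.eval_X, Polynomial.eval_C]
  rw [hψ]
  simp only [Matrix.mulVec_smul, Pi.smul_apply, Pi.sub_apply, smul_eq_mul]
  ring

/-- Induction on the degree of the denominator q. At a root of q the value of ψ vanishes, so a
linear factor cancels from both sides; a constant q leaves a polynomial ψ that is forced to be zero.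
-/
theorem HasNoChain.eq_zero_of_polynomial_solution {N K : Matrix m n ℂ}
    (hN : ∀ φ, N *ᵥ φ = 0 → φ = 0) (hNK : HasNoChain N K)
    (hreal : ∀ (z : ℂ) (φ : n → ℂ), φ ≠ 0 → K *ᵥ φ = z • N *ᵥ φ → z.im = 0) {φ : n → ℂ}
    (h : ∀ μ : ℝ, ∃ ψ, N *ᵥ φ = K *ᵥ ψ - (μ : ℂ) • N *ᵥ ψ) (d : ℕ) :
    ∀ (q : ℂ[X]) (ψ : n → ℂ[X]), q ≠ 0 → q.natDegree = d →
      K.map C *ᵥ ψ - (X : ℂ[X]) • N.map C *ᵥ ψ = (q • fun i => C ((N *ᵥ φ) i)) → φ = 0 := by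
  induction d with
  | zero =>
    intro q ψ hq hd hψ
    obtain ⟨c, rfl⟩ := Polynomial.natDegree_eq_zero.1 hd
    have hc : c ≠ 0 := fun h => hq (by rw [h, C_0])
    -- For constant q only the coefficient of degree 0 has a right-hand side; the others give a
    -- recursion, run downwards from above the degree of ψ using injectivity of N.
    have key : ∀ k, N *ᵥ (fun j => (ψ j).coeff k) = K *ᵥ (fun j => (ψ j).coeff (k + 1)) := by
      intro k
      funext i
      have := congrArg (fun p => p.coeff (k + 1)) (congrFun hψ i)
      simp only [Pi.sub_apply, Pi.smul_apply, smul_eq_mul, coeff_sub, coeff_X_mul,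
        coeff_mulVec_map_C, coeff_C_mul, coeff_C_succ, mul_zero] at this
      exact (sub_eq_zero.1 this).symm
    -- The index `j` counts steps down from one above the largest degree; after that many steps the
    -- truncated subtraction reaches 0 and `k` is arbitrary.
    have hz : ∀ j k, (fun i => (ψ i).coeff (Finset.univ.sup (fun i => (ψ i).natDegree) + 1 - j + k))
        = 0 := by
      intro j
      induction j with
      | zero =>
        intro k
        funext i
        apply Polynomial.coeff_eq_zero_of_natDegree_lt
        have := Finset.le_sup (f := fun i => (ψ i).natDegree) (Finset.mem_univ i)
        omega
      | succ j ih =>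
        intro k
        by_cases hj : Finset.univ.sup (fun i => (ψ i).natDegree) + 1 ≤ j
        · have := ih k
          rwa [show Finset.univ.sup (fun i => (ψ i).natDegree) + 1 - (j + 1) + k =
            Finset.univ.sup (fun i => (ψ i).natDegree) + 1 - j + k by omega]
        · apply hN
          rw [key]
          have := ih k
          rw [show Finset.univ.sup (fun i => (ψ i).natDegree) + 1 - (j + 1) + k + 1 =
            Finset.univ.sup (fun i => (ψ i).natDegree) + 1 - j + k by omega, this,
            Matrix.mulVec_zero]
    have h0 : ψ = 0 := by
      funext i
      ext k
      have := congrFun (hz (Finset.univ.sup (fun i => (ψ i).natDegree) + 1) k) i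
      simpa using this
    apply hN
    funext i
    have := congrFun hψ i
    rw [h0] at this
    simp only [Matrix.mulVec_zero, smul_zero, sub_zero, Pi.zero_apply, Pi.smul_apply,
      smul_eq_mul, ← C_mul] at this
    have := (C_eq_zero.1 this.symm)
    simpa [hc] using this
  | succ d ih =>
    intro q ψ hq hd hψ
    obtain ⟨z, hz⟩ := Complex.exists_root (f := q)
      (Polynomial.natDegree_pos_iff_degree_pos.1 (by omega))
    obtain ⟨q', rfl⟩ := Polynomial.dvd_iff_isRoot.2 hz
    have hq' : q' ≠ 0 := right_ne_zero_of_mul hq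
    have hd' : q'.natDegree = d := by
      rw [natDegree_mul (X_sub_C_ne_zero z) hq', natDegree_X_sub_C] at hd
      omega
    set c : n → ℂ := fun j => (ψ j).eval z with hc
    have hker : K *ᵥ c = z • N *ᵥ c := by
      funext i
      have := congrArg (fun p => p.eval z) (congrFun hψ i)
      simp only [Pi.sub_apply, Pi.smul_apply, smul_eq_mul, eval_sub, eval_mul, eval_X, eval_C,
        eval_mulVec_map_C, sub_self, zero_mul] at this
      exact sub_eq_zero.1 this
    choose ψ' hψ' using fun j => Polynomial.X_sub_C_dvd_sub_C_eval (a := z) (p := ψ j)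
    have hψe : ψ = (fun j => C (c j)) + (X - C z) • ψ' := by
      funext j
      simp only [Pi.add_apply, Pi.smul_apply, smul_eq_mul, ← hψ' j, hc]
      ring
    have hKc : K.map C *ᵥ (fun j => C (c j)) = C z • N.map C *ᵥ (fun j => C (c j)) := by
      funext i
      have := congrArg C (congrFun hker i)
      simpa [Matrix.mulVec, dotProduct, map_sum] using this
    have hNc : N.map C *ᵥ (fun j => C (c j)) = fun i => C ((N *ᵥ c) i) := by
      funext i
      simp [Matrix.mulVec, dotProduct, map_sum]
    -- Insert ψ = c + (X - z)ψ' and (K - XN)c = -(X - z)Nc, then cancel X - z.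
    have hstep : K.map C *ᵥ ψ' - (X : ℂ[X]) • N.map C *ᵥ ψ' =
        (q' • fun i => C ((N *ᵥ φ) i)) + fun i => C ((N *ᵥ c) i) := by
      rw [hψe] at hψ
      funext i
      have := congrFun hψ i
      rw [Matrix.mulVec_add, Matrix.mulVec_add, hKc, hNc] at this
      simp only [Matrix.mulVec_smul, Pi.sub_apply, Pi.add_apply, Pi.smul_apply, smul_eq_mul] at this
      apply mul_left_cancel₀ (X_sub_C_ne_zero z)
      simp only [Pi.sub_apply, Pi.add_apply, Pi.smul_apply, smul_eq_mul]
      linear_combination this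
    -- If c ≠ 0 then z is real, so Nφ = (K - zN)x for some x. Evaluating the divided identity at z
    -- gives Nc = (K - zN)(ψ'(z) - q'(z)x), a chain starting at c.
    have hc0 : c = 0 := by
      by_contra hne
      have him := hreal z c hne hker
      obtain ⟨x, hx⟩ := h z.re
      rw [show ((z.re : ℝ) : ℂ) = z from Complex.ext (by simp) (by simp [him])] at hx
      refine hne (hNK z c ((fun j => (ψ' j).eval z) - q'.eval z • x) hker ?_)
      funext i
      have h1 := congrArg (fun p => p.eval z) (congrFun hstep i)
      have h2 := congrFun hx i
      simp only [Pi.sub_apply, Pi.smul_apply, Pi.add_apply, smul_eq_mul, eval_sub, eval_mul,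
        eval_X, eval_C, eval_add, eval_mulVec_map_C] at h1 h2
      simp only [Matrix.mulVec_sub, Matrix.mulVec_smul, Pi.sub_apply, Pi.smul_apply, smul_eq_mul]
      linear_combination -h1 - q'.eval z * h2
    refine ih q' ψ' hq' hd' ?_
    rw [hstep, hc0]
    funext i
    simp

theorem HasNoChain.eq_zero_of_forall_mem_range [Fintype m] {N K : Matrix m n ℂ}
    (hN : ∀ φ, N *ᵥ φ = 0 → φ = 0) (hNK : HasNoChain N K)
    (hreal : ∀ (z : ℂ) (φ : n → ℂ), φ ≠ 0 → K *ᵥ φ = z • N *ᵥ φ → z.im = 0) {φ : n → ℂ}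
    (h : ∀ μ : ℝ, ∃ ψ, N *ᵥ φ = K *ᵥ ψ - (μ : ℂ) • N *ᵥ ψ) : φ = 0 := by
  classical
  obtain ⟨q, ψ, hq, hψ⟩ := exists_polynomial_solution hN h
  exact hNK.eq_zero_of_polynomial_solution hN hreal h _ q ψ hq rfl hψ

end Polynomial

/-! ### Construction of Hermitizable reductions. -/

section Hermitizable

variable {𝕜 : Type*} [RCLike 𝕜] {e u : ℕ}

theorem complexHom_mulVec {m n : Type*} [Fintype n] (M : Matrix m n 𝕜) (x : n → 𝕜) :
    M.map (complexHom 𝕜) *ᵥ (fun j => complexHom 𝕜 (x j)) =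
      fun i => complexHom 𝕜 ((M *ᵥ x) i) := by
  funext i
  exact (RingHom.map_mulVec (complexHom 𝕜) M x i).symm

/-- A functional vanishing on the span is a vector φ orthogonal to all the xN. By the Fredholm
alternative Nφ is then in the range of K - μN for every real μ, and the polynomial argument yields φ
= 0. -/
theorem span_leftKernel_eq_top {N K : Matrix (Fin e) (Fin u) 𝕜}
    (hN : ∀ φ, N.map (complexHom 𝕜) *ᵥ φ = 0 → φ = 0)
    (hreal : ∀ (z : ℂ) (φ : Fin u → ℂ), φ ≠ 0 →
      K.map (complexHom 𝕜) *ᵥ φ = z • N.map (complexHom 𝕜) *ᵥ φ → z.im = 0)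
    (hNK : HasNoChain (N.map (complexHom 𝕜)) (K.map (complexHom 𝕜))) :
    Submodule.span 𝕜 {w : Fin u → 𝕜 | ∃ (μ : ℝ) (x : Fin e → 𝕜),
      x ᵥ* K = (μ : 𝕜) • x ᵥ* N ∧ x ᵥ* N = w} = ⊤ := by
  by_contra hne
  obtain ⟨f, hf0, hf⟩ := Submodule.exists_le_ker_of_lt_top _ (lt_top_iff_ne_top.2 hne)
  have hfx : ∀ v, f v = v ⬝ᵥ (fun i => f (Pi.single i 1)) := fun v => by
    conv_lhs => rw [pi_eq_sum_univ' v]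
    simp [dotProduct]
  set φ : Fin u → 𝕜 := fun i => f (Pi.single i 1) with hφ
  have hrange : ∀ μ : ℝ, ∃ ψ, (K - (μ : 𝕜) • N) *ᵥ ψ = N *ᵥ φ := by
    intro μ
    apply exists_mulVec_eq_of_forall_vecMul_eq_zero
    intro x hx
    rw [Matrix.dotProduct_mulVec, ← hfx]
    refine hf (Submodule.subset_span ⟨μ, x, ?_, rfl⟩)
    rw [Matrix.vecMul_sub, Matrix.vecMul_smul] at hx
    exact sub_eq_zero.1 hx
  have hφ0 : (fun j => complexHom 𝕜 (φ j)) = 0 := by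
    apply hNK.eq_zero_of_forall_mem_range hN hreal
    intro μ
    obtain ⟨ψ, hψ⟩ := hrange μ
    refine ⟨fun j => complexHom 𝕜 (ψ j), ?_⟩
    rw [complexHom_mulVec, complexHom_mulVec, complexHom_mulVec, ← hψ]
    funext i
    simp only [Matrix.sub_mulVec, Matrix.smul_mulVec, Pi.sub_apply, Pi.smul_apply, smul_eq_mul,
      map_sub, map_mul, complexHom_ofReal]
  apply hf0
  refine LinearMap.ext fun v => ?_
  have : φ = 0 := by
    funext j
    exact (map_eq_zero (complexHom 𝕜)).1 (congrFun hφ0 j)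
  rw [hfx, this, dotProduct_zero, LinearMap.zero_apply]

/-- A pencil without Jordan chains and with real eigenvalues can be reduced to a Hermitizable
matrix. -/
theorem HasNoChain.exists_hermitizable {N K : Matrix (Fin e) (Fin u) 𝕜}
    (hN : ∀ φ, N.map (complexHom 𝕜) *ᵥ φ = 0 → φ = 0)
    (hreal : ∀ (z : ℂ) (φ : Fin u → ℂ), φ ≠ 0 →
      K.map (complexHom 𝕜) *ᵥ φ = z • N.map (complexHom 𝕜) *ᵥ φ → z.im = 0)
    (hNK : HasNoChain (N.map (complexHom 𝕜)) (K.map (complexHom 𝕜))) :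
    ∃ M : Matrix (Fin u) (Fin e) 𝕜, IsUnit (M * N) ∧ Hermitizable ((M * N)⁻¹ * (M * K)) := by
  have hspan := span_leftKernel_eq_top hN hreal hNK
  set b := Module.Basis.ofSpan hspan.ge
  set b' := b.reindex (b.indexEquiv (Pi.basisFun 𝕜 (Fin u))) with hb'
  have hmem : ∀ i, b' i ∈ {w : Fin u → 𝕜 | ∃ (μ : ℝ) (x : Fin e → 𝕜),
      x ᵥ* K = (μ : 𝕜) • x ᵥ* N ∧ x ᵥ* N = w} := fun i => by
    rw [hb', Module.Basis.reindex_apply]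
    exact Module.Basis.ofSpan_subset hspan.ge ⟨_, rfl⟩
  choose μ x hx1 hx2 using hmem
  have hXN : Matrix.of x * N = Matrix.of b' := by
    ext i j
    exact congrFun (hx2 i) j
  have hXK : Matrix.of x * K = diagonal (fun i => (μ i : 𝕜)) * Matrix.of b' := by
    ext i j
    rw [Matrix.diagonal_mul, ← hXN]
    exact congrFun (hx1 i) j
  set W : Matrix (Fin u) (Fin u) 𝕜 := Matrix.of b' with hW
  have hWu : IsUnit W := Matrix.linearIndependent_rows_iff_isUnit.1 b'.linearIndependent
  have hWi : W * W⁻¹ = 1 := Matrix.mul_nonsing_inv _ ((Matrix.isUnit_iff_isUnit_det _).1 hWu)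
  -- In the coordinates given by the rows of W the reduced matrix is the real diagonal matrix of the
  -- μ i, so the standard form in these coordinates, Wᴴ W, serves as H.
  refine ⟨Matrix.of x, hXN ▸ hWu, Wᴴ * W, ?_, ?_⟩
  · exact Matrix.PosDef.conjTranspose_mul_self _ (Matrix.mulVec_injective_iff_isUnit.2 hWu)
  · rw [hXN, hXK]
    have : Wᴴ * W * (W⁻¹ * (diagonal (fun i => (μ i : 𝕜)) * W)) =
        Wᴴ * diagonal (fun i => (μ i : 𝕜)) * W := by
      calc _ = Wᴴ * (W * W⁻¹) * diagonal (fun i => (μ i : 𝕜)) * W := by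
            simp only [Matrix.mul_assoc]
        _ = _ := by rw [hWi, Matrix.mul_one]
    rw [this]
    apply Matrix.isHermitian_conjTranspose_mul_mul
    rw [Matrix.isHermitian_diagonal_iff]
    intro i
    simp [isSelfAdjoint_iff]

end Hermitizable

end

section

open Matrix

/-! ### Chain bases of a pair of linear maps. -/

section ChainBases

open Module

/-- A linearly independent family can be completed to a basis. -/
theorem exists_basis_sum_extending {α E : Type} [AddCommGroup E] [Module ℂ E]
    [FiniteDimensional ℂ E] {v : α → E} (hv : LinearIndependent ℂ v) :
    ∃ (τ : Type) (_ : Fintype τ) (b : Basis (α ⊕ τ) ℂ E), ∀ a, b (Sum.inl a) = v a := by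
  have := Module.Finite.finite_basis (Basis.sumExtend hv)
  have hfin : Finite (Basis.sumExtendIndex hv) := Finite.of_injective
    (Sum.inr : _ → α ⊕ Basis.sumExtendIndex hv) Sum.inr_injective
  exact ⟨_, Fintype.ofFinite _, Basis.sumExtend hv, fun a => by
    rw [Basis.sumExtend, Basis.reindex_apply, Basis.extend_apply_self]
    rfl⟩

/-- Generalized eigenvectors always span over ℂ; without chains of length two each of them is an
eigenvector. -/
theorem exists_eigenvector_basis {U : Type} [AddCommGroup U] [Module ℂ U] [FiniteDimensional ℂ U]
    (A : End ℂ U)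
    (hA : ∀ (z : ℂ) (φ ψ : U), A φ = z • φ → φ = A ψ - z • ψ → φ = 0) :
    ∃ (κ : Type) (_ : Fintype κ) (μ : κ → ℂ) (b : Basis κ ℂ U), ∀ k, A (b k) = μ k • b k := by
  have hstep : ∀ (z : ℂ) (k : ℕ) (x : U), ((A - z • 1) ^ k) x = 0 → A x = z • x := by
    intro z k
    induction k with
    | zero => intro x hx; rw [show x = 0 from hx]; simp
    | succ k ih =>
      intro x hx
      rw [pow_succ, End.mul_apply] at hx
      have := hA z _ x (ih _ hx) (by simp)
      simpa [sub_eq_zero] using this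
  have hspan : ⊤ ≤ Submodule.span ℂ {x : U | ∃ z : ℂ, A x = z • x} := by
    rw [← End.iSup_maxGenEigenspace_eq_top A, iSup_le_iff]
    intro z x hx
    obtain ⟨k, hk⟩ := (End.mem_maxGenEigenspace A z x).1 hx
    exact Submodule.subset_span ⟨z, hstep z k x hk⟩
  set b := Basis.ofSpan hspan
  have hb : ∀ k, ∃ z : ℂ, A (b k) = z • b k := fun k => Basis.ofSpan_subset hspan ⟨k, rfl⟩
  choose μ hμ using hb
  exact ⟨_, FiniteDimensional.fintypeBasisIndex b, μ, b, hμ⟩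

/-- A pair of linear maps `N`, `K` is given in suitable bases by chains: `N` and `K` map chains of
length `m i` to chains of length `m i + 1`, in the two possible ways that preserve the order, and
on the further basis vectors `K` is a multiple of `N`. -/
def HasChainBases {U E : Type} [AddCommGroup U] [Module ℂ U] [AddCommGroup E] [Module ℂ E]
    (N K : U →ₗ[ℂ] E) : Prop :=
  ∃ (ι κ : Type) (_ : Fintype ι) (_ : Fintype κ) (m : ι → ℕ) (μ : κ → ℂ)
    (bU : Basis (κ ⊕ Σ i, Fin (m i)) ℂ U) (bE : Basis (κ ⊕ Σ i, Fin (m i + 1)) ℂ E),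
    (∀ k, N (bU (Sum.inl k)) = bE (Sum.inl k)) ∧
    (∀ k, K (bU (Sum.inl k)) = μ k • bE (Sum.inl k)) ∧
    (∀ i j, N (bU (Sum.inr ⟨i, j⟩)) = bE (Sum.inr ⟨i, j.castSucc⟩)) ∧
    ∀ i j, K (bU (Sum.inr ⟨i, j⟩)) = bE (Sum.inr ⟨i, j.succ⟩)

/-- The terminal case K = NA: an eigenbasis of A accounts for all of U, and a complement of the
range of N contributes chains of length 0 (zero rows). -/
theorem exists_hasChainBases_of_forall_mem_range {U E : Type} [AddCommGroup U] [Module ℂ U]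
    [FiniteDimensional ℂ U] [AddCommGroup E] [Module ℂ E] [FiniteDimensional ℂ E]
    {N K : U →ₗ[ℂ] E} (hN : Function.Injective N) (A : U →ₗ[ℂ] U) (hA : ∀ x, N (A x) = K x)
    (hNK : ∀ (z : ℂ) (φ ψ : U), K φ = z • N φ → N φ = K ψ - z • N ψ → φ = 0) :
    HasChainBases N K := by
  obtain ⟨κ, hκ, μ, b, hb⟩ := exists_eigenvector_basis A (by
    intro z φ ψ h1 h2
    refine hNK z φ ψ ?_ ?_
    · rw [← hA, h1, map_smul]
    · conv_lhs => rw [h2]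
      rw [map_sub, hA, map_smul])
  obtain ⟨τ, hτ, B, hB⟩ := exists_basis_sum_extending
    (b.linearIndependent.map' N (LinearMap.ker_eq_bot.2 hN))
  let g : κ ⊕ τ → κ ⊕ Σ _ : τ, Fin (0 + 1) := Sum.map id fun t => ⟨t, 0⟩
  have hg : Function.Bijective g := by
    constructor
    · refine Sum.map_injective.2 ⟨Function.injective_id, fun a b h => ?_⟩
      exact congrArg Sigma.fst h
    · refine Sum.map_surjective.2 ⟨Function.surjective_id, fun ⟨t, j⟩ => ⟨t, ?_⟩⟩
      rw [Fin.fin_one_eq_zero j]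
  have : IsEmpty (Σ _ : τ, Fin 0) := ⟨fun p => p.2.elim0⟩
  refine ⟨τ, κ, hτ, hκ, fun _ => 0, μ, b.reindex (Equiv.sumEmpty κ (Σ _ : τ, Fin 0)).symm,
    B.reindex (Equiv.ofBijective g hg), ?_, ?_, fun _ j => j.elim0, fun _ j => j.elim0⟩
  · intro k
    rw [show (Sum.inl k : κ ⊕ Σ _ : τ, Fin (0 + 1)) = Equiv.ofBijective g hg (Sum.inl k) from rfl,
      Basis.reindex_apply, Basis.reindex_apply, Equiv.symm_apply_apply, hB]
    rfl
  · intro k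
    rw [show (Sum.inl k : κ ⊕ Σ _ : τ, Fin (0 + 1)) = Equiv.ofBijective g hg (Sum.inl k) from rfl,
      Basis.reindex_apply, Basis.reindex_apply, Equiv.symm_apply_apply, hB]
    change K (b k) = _
    rw [← hA, hb, map_smul]
    rfl

/-- Chain bases of the inclusion and `A = N⁻¹ K` on the subspace `K⁻¹ (range N)` give chain bases
of `N` and `K`. -/
theorem HasChainBases.of_comap_range {U E : Type} [AddCommGroup U] [Module ℂ U]
    [FiniteDimensional ℂ U] [AddCommGroup E] [Module ℂ E] [FiniteDimensional ℂ E]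
    {N K : U →ₗ[ℂ] E} (hN : Function.Injective N) {V : Submodule ℂ U}
    (hV : V = (LinearMap.range N).comap K) (A : V →ₗ[ℂ] U) (hA : ∀ x, N (A x) = K x)
    (h : HasChainBases V.subtype A) : HasChainBases N K := by
  classical
  obtain ⟨ι, κ, hι, hκ, m, μ, c, b, h1, h2, h3, h4⟩ := h
  -- The image of the inclusion of V involves only the non-final vectors of each chain in U.
  have hvanish : ∀ x : U, x ∈ V → ∀ i, b.repr x (Sum.inr ⟨i, Fin.last _⟩) = 0 := by
    intro x hx i
    have : (b.coord (Sum.inr ⟨i, Fin.last _⟩)) ∘ₗ V.subtype = 0 := by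
      apply c.ext
      rintro (k | ⟨i', j⟩)
      · simp only [LinearMap.comp_apply, h1, Basis.coord_apply, Basis.repr_self,
          LinearMap.zero_apply]
        exact Finsupp.single_eq_of_ne (by simp)
      · simp only [LinearMap.comp_apply, h3, Basis.coord_apply, Basis.repr_self,
          LinearMap.zero_apply]
        refine Finsupp.single_eq_of_ne fun h => ?_
        obtain ⟨rfl, h⟩ := Sigma.mk.inj_iff.1 (Sum.inr_injective h)
        exact (Fin.castSucc_lt_last j).ne (eq_of_heq h).symm
    exact LinearMap.congr_fun this ⟨x, hx⟩
  -- In a linear relation the combination of chain ends is sent by K into the range of N. It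
  -- therefore lies in V, where end components vanish, and injectivity of N disposes of the rest.
  have hv : LinearIndependent ℂ (Sum.elim (fun x => N (b x))
      (fun i : ι => K (b (Sum.inr ⟨i, Fin.last _⟩)))) := by
    rw [Fintype.linearIndependent_iff]
    intro g hg
    rw [Fintype.sum_sum_type] at hg
    simp only [Sum.elim_inl, Sum.elim_inr, ← map_smul, ← map_sum] at hg
    have hβ : ∀ i, g (Sum.inr i) = 0 := by
      intro i
      have hmem : (∑ i, g (Sum.inr i) • b (Sum.inr ⟨i, Fin.last _⟩)) ∈ V := by
        rw [hV, Submodule.mem_comap, ← neg_eq_of_add_eq_zero_right hg, ← map_neg]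
        exact ⟨_, rfl⟩
      have := hvanish _ hmem i
      rw [map_sum, Finsupp.finsetSum_apply, Finset.sum_eq_single i] at this
      · simpa using this
      · intro i' _ hne
        rw [map_smul, Basis.repr_self, Finsupp.smul_apply, Finsupp.single_eq_of_ne, smul_zero]
        intro h
        exact hne (congrArg Sigma.fst (Sum.inr_injective h)).symm
      · simp
    rintro (x | i)
    · simp only [hβ, zero_smul, Finset.sum_const_zero, map_zero, add_zero] at hg
      exact Fintype.linearIndependent_iff.1 b.linearIndependent _
        (hN (hg.trans (map_zero N).symm)) x
    · exact hβ i
  obtain ⟨τ, hτ, B, hB⟩ := exists_basis_sum_extending hv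
  -- Each old chain grows by one vector: its m i + 1 vectors in U become the domain part, with N of
  -- them and K of the last as the target part. The completing vectors indexed by τ are new chains
  -- of length 0.
  let m' : ι ⊕ τ → ℕ := Sum.elim (fun i => m i + 1) fun _ => 0
  let gU : (κ ⊕ Σ i, Fin (m i + 1)) → κ ⊕ Σ i, Fin (m' i) :=
    Sum.map id fun p => ⟨Sum.inl p.1, p.2⟩
  have hgU : Function.Bijective gU := by
    constructor
    · refine Sum.map_injective.2 ⟨Function.injective_id, fun ⟨i, j⟩ ⟨i', j'⟩ h => ?_⟩
      obtain ⟨h5, h6⟩ := Sigma.mk.inj_iff.1 h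
      obtain rfl := Sum.inl_injective h5
      exact Sigma.mk.inj_iff.2 ⟨rfl, h6⟩
    · refine Sum.map_surjective.2 ⟨Function.surjective_id, ?_⟩
      rintro ⟨i | t, j⟩
      · exact ⟨⟨i, j⟩, rfl⟩
      · exact j.elim0
  let gE : (((κ ⊕ Σ i, Fin (m i + 1)) ⊕ ι) ⊕ τ) → κ ⊕ Σ i, Fin (m' i + 1) :=
    Sum.elim (Sum.elim (Sum.map id fun p => ⟨Sum.inl p.1, Fin.castSucc p.2⟩)
      fun i => Sum.inr ⟨Sum.inl i, Fin.last _⟩) fun t => Sum.inr ⟨Sum.inr t, 0⟩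
  have hgE : Function.Bijective gE := by
    constructor
    · rintro (((k | ⟨i, j⟩) | i) | t) (((k' | ⟨i', j'⟩) | i') | t') h
      all_goals first
        | cases h; rfl
        | (exfalso; cases h)
        | skip
      · obtain ⟨h5, h6⟩ := Sigma.mk.inj_iff.1 (Sum.inr_injective h)
        obtain rfl := Sum.inl_injective h5
        have h7 := Fin.castSucc_injective _ (eq_of_heq h6)
        dsimp only at h7
        rw [h7]
      · obtain ⟨h5, h6⟩ := Sigma.mk.inj_iff.1 (Sum.inr_injective h)
        obtain rfl := Sum.inl_injective h5
        exact absurd (eq_of_heq h6) (Fin.castSucc_lt_last j).ne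
      · obtain ⟨h5, h6⟩ := Sigma.mk.inj_iff.1 (Sum.inr_injective h)
        obtain rfl := Sum.inl_injective h5
        exact absurd (eq_of_heq h6) (Fin.castSucc_lt_last j').ne'
    · rintro (k | ⟨i | t, j⟩)
      · exact ⟨Sum.inl (Sum.inl (Sum.inl k)), rfl⟩
      · induction j using Fin.lastCases with
        | last => exact ⟨Sum.inl (Sum.inr i), rfl⟩
        | cast j => exact ⟨Sum.inl (Sum.inl (Sum.inr ⟨i, j⟩)), rfl⟩
      · refine ⟨Sum.inr t, ?_⟩
        have : j = 0 := Fin.ext (Nat.lt_one_iff.1 j.2)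
        rw [this]
        rfl
  have hbU : ∀ x, b.reindex (Equiv.ofBijective gU hgU) (gU x) = b x := fun x => by
    rw [Basis.reindex_apply]
    exact congrArg b ((Equiv.ofBijective gU hgU).symm_apply_apply x)
  have hbE : ∀ x, B.reindex (Equiv.ofBijective gE hgE) (gE x) = B x := fun x => by
    rw [Basis.reindex_apply]
    exact congrArg B ((Equiv.ofBijective gE hgE).symm_apply_apply x)
  refine ⟨ι ⊕ τ, κ, inferInstance, hκ, m', μ, b.reindex (Equiv.ofBijective gU hgU),
    B.reindex (Equiv.ofBijective gE hgE), ?_, ?_, ?_, ?_⟩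
  · intro k
    exact (congrArg N (hbU (Sum.inl k))).trans
      (((hbE (Sum.inl (Sum.inl (Sum.inl k)))).trans (hB _)).symm)
  · intro k
    refine (congrArg K (hbU (Sum.inl k))).trans ?_
    have h5 := (hbE (Sum.inl (Sum.inl (Sum.inl k)))).trans (hB _)
    refine Eq.trans ?_ (congrArg (fun x => μ k • x) h5.symm)
    rw [← h1, Submodule.subtype_apply, ← hA, h2]
    simp
  · rintro (i | t) j
    · exact (congrArg N (hbU (Sum.inr ⟨i, j⟩))).trans
        (((hbE (Sum.inl (Sum.inl (Sum.inr ⟨i, j⟩)))).trans (hB _)).symm)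
    · exact j.elim0
  · rintro (i | t) j
    · refine (congrArg K (hbU (Sum.inr ⟨i, j⟩))).trans ?_
      induction j using Fin.lastCases with
      | last => exact ((hbE (Sum.inl (Sum.inr i))).trans (hB _)).symm
      | cast j =>
        have h5 := (hbE (Sum.inl (Sum.inl (Sum.inr ⟨i, j.succ⟩)))).trans (hB _)
        refine Eq.trans ?_ h5.symm
        rw [← h3, Submodule.subtype_apply, ← hA, h4]
        rfl
    · exact j.elim0

/-- Let V be the vectors that K sends into the range of N. If V is everything, K = NA; otherwise V
has smaller dimension and the pair (inclusion, N⁻¹K) on V inherits injectivity and the absence of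
chains. -/
theorem hasChainBases_of_finrank_le (d : ℕ) : ∀ {U E : Type} [AddCommGroup U] [Module ℂ U]
    [FiniteDimensional ℂ U] [AddCommGroup E] [Module ℂ E] [FiniteDimensional ℂ E]
    {N K : U →ₗ[ℂ] E}, finrank ℂ U ≤ d → Function.Injective N →
    (∀ (z : ℂ) (φ ψ : U), K φ = z • N φ → N φ = K ψ - z • N ψ → φ = 0) →
    HasChainBases N K := by
  induction d with
  | zero =>
    intro U E _ _ _ _ _ _ N K hd hN hNK
    have : Subsingleton U := finrank_zero_iff.1 (Nat.le_zero.1 hd)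
    refine exists_hasChainBases_of_forall_mem_range hN 0 (fun x => ?_) hNK
    rw [Subsingleton.elim x 0]
    simp
  | succ d ih =>
    intro U E _ _ _ _ _ _ N K hd hN hNK
    have hinv : ∀ x : (LinearMap.range N).comap K, ∃ y, N y = K x := fun x => x.2
    choose f hf using hinv
    let A : (LinearMap.range N).comap K →ₗ[ℂ] U :=
      { toFun := f
        map_add' := fun x y => hN (by simp [hf])
        map_smul' := fun c x => hN (by simp [hf]) }
    have hA : ∀ x, N (A x) = K x := hf
    by_cases htop : (LinearMap.range N).comap K = ⊤
    · exact exists_hasChainBases_of_forall_mem_range hN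
        (A ∘ₗ LinearMap.id.codRestrict _ fun x => htop ▸ Submodule.mem_top) (fun x => hA _) hNK
    · refine HasChainBases.of_comap_range hN rfl A hA (ih ?_ (Submodule.injective_subtype _) ?_)
      · have := Submodule.finrank_lt htop
        omega
      · intro z φ ψ h1 h2
        apply Subtype.ext
        refine hNK z φ ψ ?_ ?_
        · rw [← hA, h1, map_smul]
          rfl
        · have := congrArg N h2
          rwa [map_sub, map_smul, hA] at this

theorem hasChainBases {U E : Type} [AddCommGroup U] [Module ℂ U]
    [FiniteDimensional ℂ U] [AddCommGroup E] [Module ℂ E] [FiniteDimensional ℂ E]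
    {N K : U →ₗ[ℂ] E} (hN : Function.Injective N)
    (hNK : ∀ (z : ℂ) (φ ψ : U), K φ = z • N φ → N φ = K ψ - z • N ψ → φ = 0) :
    HasChainBases N K :=
  hasChainBases_of_finrank_le _ le_rfl hN hNK

end ChainBases

end

section

open Matrix Module

/-! ### Kronecker decompositions expressed through bases. -/

section Bases

variable {e u b : ℕ} {P : ℂ → Matrix (Fin e) (Fin u) ℂ} {B : Fin b → KroneckerBlock}

/-- Bases in which the pencil `P` consists of the blocks `B i`. -/
def IsKroneckerBasisPair {β : Type} (P : ℂ → Matrix (Fin e) (Fin u) ℂ) (B : β → KroneckerBlock)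
    (bU : Basis (Σ i, Fin (B i).cols) ℂ (Fin u → ℂ))
    (bE : Basis (Σ i, Fin (B i).rows) ℂ (Fin e → ℂ)) : Prop :=
  ∀ z i j, P z *ᵥ bU ⟨i, j⟩ = ∑ r, (B i).pencil z r j • bE ⟨i, r⟩

theorem blockDiagonal'_mulVec_single {β : Type} [Fintype β] [DecidableEq β] {c r : β → ℕ}
    (M : ∀ i, Matrix (Fin (r i)) (Fin (c i)) ℂ) (i : β) (j : Fin (c i)) :
    Matrix.blockDiagonal' M *ᵥ Pi.single ⟨i, j⟩ 1 = ∑ s, M i s j • Pi.single ⟨i, s⟩ 1 := by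
  funext ⟨i', s⟩
  rw [Matrix.mulVec_single_one, Matrix.col_apply, Finset.sum_apply]
  by_cases h : i' = i
  · subst h
    rw [Matrix.blockDiagonal'_apply_eq, Finset.sum_eq_single s]
    · simp
    · intro s' _ hne
      rw [Pi.smul_apply, Pi.single_eq_of_ne, smul_zero]
      intro h
      exact hne (eq_of_heq (Sigma.mk.inj_iff.1 h).2).symm
    · simp
  · rw [Matrix.blockDiagonal'_apply_ne _ _ _ h, Finset.sum_eq_zero]
    intro s' _
    rw [Pi.smul_apply, Pi.single_eq_of_ne, smul_zero]
    intro h'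
    exact h (Sigma.mk.inj_iff.1 h').1

theorem reindex_mulVec_single {α β γ δ : Type*} [Fintype β] [Fintype δ] [DecidableEq α]
    [DecidableEq β] [DecidableEq γ] [DecidableEq δ] (f : α ≃ γ) (g : β ≃ δ) (M : Matrix α β ℂ)
    (x : β) : M.reindex f g *ᵥ Pi.single (g x) 1 = (M *ᵥ Pi.single x 1) ∘ f.symm := by
  funext i
  simp

theorem IsKroneckerDecomposition.exists_isKroneckerBasisPair
    (h : IsKroneckerDecomposition P B) : ∃ bU bE, IsKroneckerBasisPair P B bU bE := by
  obtain ⟨er, ec, Y, W, hY, hW, h⟩ := h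
  have hWd := (Matrix.isUnit_iff_isUnit_det _).1 hW
  have hWW : W * W⁻¹ = 1 := Matrix.mul_nonsing_inv _ hWd
  have hYl : LinearIndependent ℂ Y.col := Matrix.linearIndependent_cols_iff_isUnit.2 hY
  have hWl : LinearIndependent ℂ (W⁻¹).col :=
    Matrix.linearIndependent_cols_iff_isUnit.2 (Matrix.isUnit_nonsing_inv_iff.2 hW)
  -- From P = Y K W the columns of W⁻¹ are the basis of the domain and the columns of Y that of the
  -- target.
  refine ⟨(Basis.mk hWl (hWl.span_eq_top_of_card_eq_finrank' (by simp)).ge).reindex ec.symm,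
    (Basis.mk hYl (hYl.span_eq_top_of_card_eq_finrank' (by simp)).ge).reindex er.symm, ?_⟩
  intro z i j
  simp only [Basis.reindex_apply, Equiv.symm_symm, Basis.coe_mk]
  rw [← Matrix.mulVec_single_one, Matrix.mulVec_mulVec, h z, Matrix.mul_assoc, hWW,
    Matrix.mul_one, ← Matrix.mulVec_mulVec, reindex_mulVec_single, blockDiagonal'_mulVec_single]
  have : ∀ s, Y.col (er ⟨i, s⟩) = Y *ᵥ (Pi.single (⟨i, s⟩ : Σ i, Fin (B i).rows) 1 ∘ er.symm) := by
    intro s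
    rw [← Matrix.mulVec_single_one]
    congr 1
    funext q
    simp only [Function.comp_apply, Pi.single_apply, Equiv.symm_apply_eq]
  simp only [this, ← Matrix.mulVec_smul, ← Matrix.mulVec_sum]
  congr 1
  funext q
  simp [Finset.sum_apply]

theorem IsKroneckerBasisPair.isKroneckerDecomposition {bU bE}
    (h : IsKroneckerBasisPair P B bU bE) : IsKroneckerDecomposition P B := by
  set er := bE.indexEquiv (Pi.basisFun ℂ (Fin e))
  set ec := bU.indexEquiv (Pi.basisFun ℂ (Fin u))
  set Y : Matrix (Fin e) (Fin e) ℂ := Matrix.of fun i q => bE (er.symm q) i with hYdef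
  set V : Matrix (Fin u) (Fin u) ℂ := Matrix.of fun i q => bU (ec.symm q) i with hVdef
  have hY : IsUnit Y := Matrix.linearIndependent_cols_iff_isUnit.1
    (bE.linearIndependent.comp er.symm er.symm.injective)
  have hV : IsUnit V := Matrix.linearIndependent_cols_iff_isUnit.1
    (bU.linearIndependent.comp ec.symm ec.symm.injective)
  have hVV : V * V⁻¹ = 1 := Matrix.mul_nonsing_inv _ ((Matrix.isUnit_iff_isUnit_det _).1 hV)
  refine ⟨er, ec, Y, V⁻¹, hY, Matrix.isUnit_nonsing_inv_iff.2 hV, fun z => ?_⟩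
  suffices hs : P z * V = Y * (Matrix.blockDiagonal' fun i => (B i).pencil z).reindex er ec by
    rw [← hs, Matrix.mul_assoc, hVV, Matrix.mul_one]
  apply Matrix.ext_of_mulVec_single
  intro q
  obtain ⟨⟨i, j⟩, rfl⟩ := ec.surjective q
  have hVcol : V *ᵥ Pi.single (ec ⟨i, j⟩) 1 = bU ⟨i, j⟩ := by
    rw [Matrix.mulVec_single_one]
    funext i'
    simp [hVdef]
  have hYcol : ∀ s, Y *ᵥ (Pi.single (⟨i, s⟩ : Σ i, Fin (B i).rows) 1 ∘ er.symm) = bE ⟨i, s⟩ := by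
    intro s
    have : (Pi.single (⟨i, s⟩ : Σ i, Fin (B i).rows) (1 : ℂ) ∘ er.symm) =
        Pi.single (er ⟨i, s⟩) 1 := by
      funext q
      simp only [Function.comp_apply, Pi.single_apply, Equiv.symm_apply_eq]
    rw [this, Matrix.mulVec_single_one]
    funext i'
    simp [hYdef]
  rw [← Matrix.mulVec_mulVec, ← Matrix.mulVec_mulVec, hVcol, h, reindex_mulVec_single,
    blockDiagonal'_mulVec_single]
  simp only [← hYcol, ← Matrix.mulVec_smul, ← Matrix.mulVec_sum]
  congr 1
  funext q
  simp [Finset.sum_apply]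

theorem IsKroneckerBasisPair.exists_isKroneckerDecomposition {β : Type} [Fintype β]
    {B : β → KroneckerBlock} {bU bE} (h : IsKroneckerBasisPair P B bU bE) :
    ∃ (b : ℕ) (f : Fin b → β), IsKroneckerDecomposition P (B ∘ f) := by
  let f := (Fintype.equivFin β).symm
  refine ⟨_, f, IsKroneckerBasisPair.isKroneckerDecomposition
    (bU := bU.reindex (Equiv.sigmaCongrLeft (β := fun i => Fin (B i).cols) f).symm)
    (bE := bE.reindex (Equiv.sigmaCongrLeft (β := fun i => Fin (B i).rows) f).symm) ?_⟩
  intro z i j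
  simp only [Basis.reindex_apply, Equiv.symm_symm, Equiv.sigmaCongrLeft_apply]
  exact h z (f i) j

theorem IsKroneckerBasisPair.mulVec_sum {β : Type} {B : β → KroneckerBlock} {bU bE}
    (h : IsKroneckerBasisPair P B bU bE) (z : ℂ) (i : β) (v : Fin (B i).cols → ℂ) :
    P z *ᵥ (∑ j, v j • bU ⟨i, j⟩) = ∑ r, ((B i).pencil z *ᵥ v) r • bE ⟨i, r⟩ := by
  simp only [Matrix.mulVec_sum, Matrix.mulVec_smul, h z i, Finset.smul_sum, smul_smul]
  rw [Finset.sum_comm]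
  refine Finset.sum_congr rfl fun r _ => ?_
  rw [← Finset.sum_smul]
  congr 1
  simp [Matrix.mulVec, dotProduct, mul_comm]

theorem IsKroneckerBasisPair.repr_mulVec {β : Type} [Fintype β] {B : β → KroneckerBlock} {bU bE}
    (h : IsKroneckerBasisPair P B bU bE) (z : ℂ) (φ : Fin u → ℂ) (i : β) (r : Fin (B i).rows) :
    bE.repr (P z *ᵥ φ) ⟨i, r⟩ =
      ((B i).pencil z *ᵥ fun j => bU.repr φ ⟨i, j⟩) r := by
  have hφ : φ = ∑ i, ∑ j, bU.repr φ ⟨i, j⟩ • bU ⟨i, j⟩ := by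
    conv_lhs => rw [← bU.sum_repr φ]
    rw [Fintype.sum_sigma]
  have : P z *ᵥ φ = ∑ p : Σ i, Fin (B i).rows,
      ((B p.1).pencil z *ᵥ fun j => bU.repr φ ⟨p.1, j⟩) p.2 • bE p := by
    conv_lhs => rw [hφ]
    rw [Matrix.mulVec_sum, Fintype.sum_sigma]
    exact Finset.sum_congr rfl fun i _ => h.mulVec_sum z i _
  rw [this, bE.repr_sum_self]

end Bases

/-! ### Block types allowed by the absence of Jordan chains. -/

section Blocks

/-- This is the absence of chains for one block: the difference of a pencil K - zN at 0 and at 1 is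
N. An `LT` block is injective for every z, by back substitution from the last row. -/
theorem KroneckerBlock.IsTrivial.eq_zero {B : KroneckerBlock} (hB : B.IsTrivial) {z : ℂ}
    {a c : Fin B.cols → ℂ} (h1 : B.pencil z *ᵥ a = 0)
    (h2 : B.pencil 0 *ᵥ a - B.pencil 1 *ᵥ a = B.pencil z *ᵥ c) : a = 0 := by
  cases B with
  | jordan μ m hm =>
    obtain rfl : m = 1 := hB
    have hp : ∀ (w : ℂ) (v : Fin 1 → ℂ),
        ((KroneckerBlock.jordan μ 1 hm).pencil w *ᵥ v) (0 : Fin 1) = (w - μ) * v 0 := by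
      intro w v
      change ∑ j : Fin 1, (KroneckerBlock.jordan μ 1 hm).entry w (0 : Fin 1) j * v j = _
      rw [Fin.sum_univ_one]
      simp [KroneckerBlock.entry]
    have h1 := (hp z a).symm.trans (congrFun h1 (0 : Fin 1))
    have h2 := (congrArg₂ (fun x y => x - y) (hp 0 a) (hp 1 a)).symm.trans
      ((congrFun h2 (0 : Fin 1)).trans (hp z c))
    funext j
    obtain rfl : j = (0 : Fin 1) := Fin.fin_one_eq_zero j
    rcases mul_eq_zero.1 h1 with h | h
    · rw [h] at h2
      change a (0 : Fin 1) = 0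
      linear_combination -h2
    · exact h
  | infinite m hm => exact hB.elim
  | L m => exact hB.elim
  | LT m =>
    change Fin m → ℂ at a
    have key : ∀ j : Fin m, a j = 0 := by
      intro j
      induction j using WellFoundedGT.induction with
      | ind j ih =>
        have h := congrFun h1 j.succ
        change ∑ j' : Fin m, (KroneckerBlock.LT m).entry z j.succ j' * a j' = 0 at h
        rw [Finset.sum_eq_single j] at h
        · simpa [KroneckerBlock.entry] using h
        · intro j' _ hne
          simp only [KroneckerBlock.entry, Fin.val_succ]
          split_ifs with h3 h4
          · rw [ih j' (by rw [Fin.lt_def]; omega), mul_zero]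
          · exact absurd (Fin.ext (by omega)) hne
          · rw [zero_mul]
        · simp
    exact funext key

theorem IsKroneckerBasisPair.hasNoChain {e u : ℕ} {N K : Matrix (Fin e) (Fin u) ℂ} {β : Type}
    [Fintype β] {B : β → KroneckerBlock} {bU bE}
    (h : IsKroneckerBasisPair (fun z => K - z • N) B bU bE) (hB : ∀ i, (B i).IsTrivial) :
    HasNoChain N K := by
  intro z φ ψ h1 h2
  have h1' : (K - z • N) *ᵥ φ = 0 := by
    rw [Matrix.sub_mulVec, Matrix.smul_mulVec, h1, sub_self]
  have h2' : (K - (0 : ℂ) • N) *ᵥ φ - (K - (1 : ℂ) • N) *ᵥ φ = (K - z • N) *ᵥ ψ := by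
    simp only [Matrix.sub_mulVec, Matrix.smul_mulVec]
    rw [← h2]
    simp
  apply bU.repr.map_eq_zero_iff.1
  ext ⟨i, j⟩
  have hz := (hB i).eq_zero (z := z) (a := fun j => bU.repr φ ⟨i, j⟩)
    (c := fun j => bU.repr ψ ⟨i, j⟩)
    (by
      funext r
      rw [← h.repr_mulVec z φ i r, h1', map_zero]
      rfl)
    (by
      funext r
      rw [Pi.sub_apply, ← h.repr_mulVec z ψ i r, ← h.repr_mulVec 0 φ i r,
        ← h.repr_mulVec 1 φ i r, ← h2', map_sub]
      rfl)
  exact congrFun hz j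

/-- Each forbidden block produces a contradiction: a Jordan block of size at least 2 contains a
chain, an infinite block a kernel vector of N, and an `L` block a kernel vector at every z, in
particular at the regular point z₀. -/
theorem HasNoChain.isTrivial_of_forall_mulVec {e u : ℕ} {N K : Matrix (Fin e) (Fin u) ℂ}
    (hN : ∀ φ, N *ᵥ φ = 0 → φ = 0) {z₀ : ℂ} (hz₀ : ∀ φ, K *ᵥ φ = z₀ • N *ᵥ φ → φ = 0)
    (hNK : HasNoChain N K) {B : KroneckerBlock} {x : Fin B.cols → Fin u → ℂ}
    {y : Fin B.rows → Fin e → ℂ} (hx : LinearIndependent ℂ x)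
    (h : ∀ z j, (K - z • N) *ᵥ x j = ∑ r, B.pencil z r j • y r) : B.IsTrivial := by
  have hdiff : ∀ (z : ℂ) φ, N *ᵥ φ = (K - z • N) *ᵥ φ - (K - (z + 1) • N) *ᵥ φ := by
    intro z φ
    simp only [Matrix.sub_mulVec, Matrix.smul_mulVec, Matrix.add_mulVec, add_smul, one_smul]
    abel
  cases B with
  | jordan μ m hm =>
    by_contra hne
    have hm2 : 1 < m := lt_of_le_of_ne hm (Ne.symm hne)
    change Fin m → _ at x y
    set j₀ : Fin m := ⟨0, hm⟩ with hj₀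
    set j₁ : Fin m := ⟨1, hm2⟩ with hj₁
    have h0 : ∀ z : ℂ, (K - z • N) *ᵥ x j₀ = (z - μ) • y j₀ := by
      intro z
      refine (h z j₀).trans ?_
      change ∑ r : Fin m, (KroneckerBlock.jordan μ m hm).entry z r j₀ • y r = _
      rw [Finset.sum_eq_single j₀]
      · simp [KroneckerBlock.entry]
      · intro r _ hr
        have : (r : ℕ) ≠ 0 := fun h => hr (Fin.ext h)
        simp [KroneckerBlock.entry, hj₀, this]
      · simp
    have h1 : (K - μ • N) *ᵥ x j₁ = y j₀ := by
      refine (h μ j₁).trans ?_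
      change ∑ r : Fin m, (KroneckerBlock.jordan μ m hm).entry μ r j₁ • y r = _
      rw [Finset.sum_eq_single j₀]
      · simp [KroneckerBlock.entry, hj₀, hj₁]
      · intro r _ hr
        have : (r : ℕ) ≠ 0 := fun h => hr (Fin.ext h)
        by_cases hr1 : (r : ℕ) = 1
        · simp [KroneckerBlock.entry, hj₁, hr1]
        · simp [KroneckerBlock.entry, hj₁, hr1, this]
      · simp
    -- The sign comes from N x₀ = P(μ)x₀ - P(μ + 1)x₀ = -y₀, while P(μ)x₁ = y₀.
    refine hx.ne_zero j₀ (hNK μ (x j₀) (-x j₁) ?_ ?_)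
    · have := h0 μ
      rwa [sub_self, zero_smul, Matrix.sub_mulVec, Matrix.smul_mulVec, sub_eq_zero] at this
    · rw [hdiff μ, h0, h0, Matrix.mulVec_neg, Matrix.mulVec_neg, smul_neg, ← neg_sub', ← h1,
        Matrix.sub_mulVec, Matrix.smul_mulVec]
      simp
  | infinite m hm =>
    change Fin m → _ at x y
    set j₀ : Fin m := ⟨0, hm⟩ with hj₀
    have h0 : ∀ z : ℂ, (K - z • N) *ᵥ x j₀ = y j₀ := by
      intro z
      refine (h z j₀).trans ?_
      change ∑ r : Fin m, (KroneckerBlock.infinite m hm).entry z r j₀ • y r = _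
      rw [Finset.sum_eq_single j₀]
      · simp [KroneckerBlock.entry]
      · intro r _ hr
        have : (r : ℕ) ≠ 0 := fun h => hr (Fin.ext h)
        simp [KroneckerBlock.entry, hj₀, this]
      · simp
    refine absurd (hN (x j₀) ?_) (hx.ne_zero j₀)
    rw [hdiff 0, h0, h0, sub_self]
  | L m =>
    exfalso
    have hker := LinearMap.ker_ne_bot_of_finrank_lt
      (f := ((KroneckerBlock.L m).pencil z₀).mulVecLin)
      (by
        change finrank ℂ (Fin m → ℂ) < finrank ℂ (Fin (m + 1) → ℂ)
        simp)
    obtain ⟨v, hv, hv0⟩ := (Submodule.ne_bot_iff _).1 hker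
    apply hv0
    refine funext (Fintype.linearIndependent_iff.1 hx v (hz₀ _ (sub_eq_zero.1 ?_)))
    rw [← Matrix.smul_mulVec, ← Matrix.sub_mulVec, Matrix.mulVec_sum]
    simp only [Matrix.mulVec_smul, h, Finset.smul_sum, smul_smul]
    rw [Finset.sum_comm]
    refine Finset.sum_eq_zero fun r _ => ?_
    rw [← Finset.sum_smul]
    have : ∑ j, v j * (KroneckerBlock.L m).pencil z₀ r j = 0 := by
      simp only [mul_comm (v _)]
      exact congrFun (LinearMap.mem_ker.1 hv) r
    rw [this, zero_smul]
  | LT m => trivial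

theorem HasNoChain.exists_isKroneckerBasisPair {e u : ℕ} {N K : Matrix (Fin e) (Fin u) ℂ}
    (hN : ∀ φ, N *ᵥ φ = 0 → φ = 0) (hNK : HasNoChain N K) :
    ∃ (β : Type) (_ : Fintype β) (B : β → KroneckerBlock) (bU : _) (bE : _),
      IsKroneckerBasisPair (fun z => K - z • N) B bU bE ∧ ∀ i, (B i).IsTrivial := by
  -- The chain bases are taken for -N, the coefficient of z in the pencil, since the blocks carry
  -- +z; the eigenvalues therefore reappear as -μ.
  obtain ⟨ι, κ, hι, hκ, m, μ, bU, bE, h1, h2, h3, h4⟩ :=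
    hasChainBases (N := (-N).mulVecLin) (K := K.mulVecLin)
      (LinearMap.ker_eq_bot.1 (LinearMap.ker_eq_bot'.2 fun φ hφ => hN φ (by
        simpa [Matrix.neg_mulVec] using hφ)))
      (by
        intro z φ ψ h1 h2
        simp only [Matrix.mulVecLin_apply, Matrix.neg_mulVec] at h1 h2
        refine hNK (-z) φ (-ψ) ?_ ?_
        · rw [h1]; simp
        · rw [← neg_neg (N *ᵥ φ), h2, Matrix.mulVec_neg, Matrix.mulVec_neg]
          simp only [smul_neg, neg_smul]
          abel)
  simp only [Matrix.mulVecLin_apply, Matrix.neg_mulVec] at h1 h2 h3 h4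
  let B : κ ⊕ ι → KroneckerBlock :=
    Sum.elim (fun k => .jordan (-μ k) 1 le_rfl) fun i => .LT (m i)
  let gU : (κ ⊕ Σ i, Fin (m i)) → Σ i, Fin (B i).cols :=
    Sum.elim (fun k => ⟨Sum.inl k, (0 : Fin 1)⟩) fun p => ⟨Sum.inr p.1, p.2⟩
  have hgU : Function.Bijective gU := by
    constructor
    · rintro (k | ⟨i, j⟩) (k' | ⟨i', j'⟩) h
      all_goals
        cases h
        try rfl
    · rintro ⟨k | i, j⟩
      · exact ⟨Sum.inl k, Sigma.ext rfl (heq_of_eq (Fin.fin_one_eq_zero j).symm)⟩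
      · exact ⟨Sum.inr ⟨i, j⟩, rfl⟩
  let gE : (κ ⊕ Σ i, Fin (m i + 1)) → Σ i, Fin (B i).rows :=
    Sum.elim (fun k => ⟨Sum.inl k, (0 : Fin 1)⟩) fun p => ⟨Sum.inr p.1, p.2⟩
  have hgE : Function.Bijective gE := by
    constructor
    · rintro (k | ⟨i, j⟩) (k' | ⟨i', j'⟩) h
      all_goals
        cases h
        try rfl
    · rintro ⟨k | i, j⟩
      · exact ⟨Sum.inl k, Sigma.ext rfl (heq_of_eq (Fin.fin_one_eq_zero j).symm)⟩
      · exact ⟨Sum.inr ⟨i, j⟩, rfl⟩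
  have hbU : ∀ x, bU.reindex (Equiv.ofBijective gU hgU) (gU x) = bU x := fun x => by
    rw [Basis.reindex_apply]
    exact congrArg bU ((Equiv.ofBijective gU hgU).symm_apply_apply x)
  have hbE : ∀ x, bE.reindex (Equiv.ofBijective gE hgE) (gE x) = bE x := fun x => by
    rw [Basis.reindex_apply]
    exact congrArg bE ((Equiv.ofBijective gE hgE).symm_apply_apply x)
  refine ⟨κ ⊕ ι, inferInstance, B, bU.reindex (Equiv.ofBijective gU hgU),
    bE.reindex (Equiv.ofBijective gE hgE), ?_, ?_⟩
  · rintro z (k | i) j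
    · obtain rfl : j = (0 : Fin 1) := Fin.fin_one_eq_zero j
      refine (congrArg (fun x => (K - z • N) *ᵥ x) (hbU (Sum.inl k))).trans ?_
      refine Eq.trans ?_ (Fin.sum_univ_one _).symm
      refine Eq.trans ?_ (congrArg (fun x => (KroneckerBlock.jordan (-μ k) 1 le_rfl).entry z 0 0 • x)
        (hbE (Sum.inl k)).symm)
      have : N *ᵥ bU (Sum.inl k) = - bE (Sum.inl k) := by rw [← h1, neg_neg]
      rw [Matrix.sub_mulVec, Matrix.smul_mulVec, h2, this]
      simp only [KroneckerBlock.entry, if_true, sub_smul, smul_neg, neg_smul]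
      abel
    · change Fin (m i) at j
      refine (congrArg (fun x => (K - z • N) *ᵥ x) (hbU (Sum.inr ⟨i, j⟩))).trans ?_
      have hsum : ∀ y : Fin (m i + 1) → Fin e → ℂ,
          ∑ r : Fin (m i + 1), (KroneckerBlock.LT (m i)).entry z r j • y r = z • y j.castSucc + y j.succ := by
        intro y
        have : ∀ r : Fin (m i + 1), (KroneckerBlock.LT (m i)).entry z r j • y r =
            (if r = j.castSucc then z • y r else 0) + (if r = j.succ then y r else 0) := by
          intro r
          have hr1 : r = j.castSucc ↔ (r : ℕ) = j := by simp [Fin.ext_iff]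
          have hr2 : r = j.succ ↔ (r : ℕ) = j + 1 := by simp [Fin.ext_iff]
          simp only [KroneckerBlock.entry, hr1, hr2]
          split_ifs with h5 h6
          · omega
          · simp
          · simp
          · simp
        simp [this, Finset.sum_add_distrib]
      refine Eq.trans ?_ (hsum fun r => bE.reindex (Equiv.ofBijective gE hgE)
        (gE (Sum.inr ⟨i, r⟩))).symm
      rw [hbE, hbE, ← h3, ← h4, Matrix.sub_mulVec, Matrix.smul_mulVec]
      simp only [smul_neg]
      abel
  · rintro (k | i)
    · rfl
    · trivial

theorem trivialKronecker_iff {e u : ℕ} {N K : Matrix (Fin e) (Fin u) ℂ}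
    (hN : ∀ φ, N *ᵥ φ = 0 → φ = 0) {z₀ : ℂ} (hz₀ : ∀ φ, K *ᵥ φ = z₀ • N *ᵥ φ → φ = 0) :
    TrivialKronecker (fun z => K - z • N) ↔ HasNoChain N K := by
  constructor
  · rintro ⟨⟨b, B, hB, hBt⟩, -⟩
    obtain ⟨bU, bE, h⟩ := hB.exists_isKroneckerBasisPair
    exact h.hasNoChain hBt
  · intro hNK
    constructor
    · obtain ⟨β, _, B, bU, bE, h, hB⟩ := hNK.exists_isKroneckerBasisPair hN
      obtain ⟨b, f, hf⟩ := h.exists_isKroneckerDecomposition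
      exact ⟨b, B ∘ f, hf, fun i => hB (f i)⟩
    · intro b B hB i
      obtain ⟨bU, bE, h⟩ := hB.exists_isKroneckerBasisPair
      exact hNK.isTrivial_of_forall_mulVec hN hz₀
        (x := fun j => bU ⟨i, j⟩) (y := fun r => bE ⟨i, r⟩)
        (bU.linearIndependent.comp (fun j => (⟨i, j⟩ : Σ i, Fin (B i).cols))
          fun _ _ h => eq_of_heq (Sigma.mk.inj_iff.1 h).2) fun z j => h z i j

end Blocks

end

section

open Module Filter Topology

/-! ### Norm bounds for linear maps. -/

section Bounds

variable {E F : Type*} [NormedAddCommGroup E] [InnerProductSpace ℂ E] [FiniteDimensional ℂ E]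
  [NormedAddCommGroup F] [InnerProductSpace ℂ F] (T : E →ₗ[ℂ] F)

theorem exists_pos_forall_norm_apply_le : ∃ C : ℝ, 0 < C ∧ ∀ x, ‖T x‖ ≤ C * ‖x‖ := by
  refine ⟨‖T.toContinuousLinearMap‖ + 1, by positivity, fun x => ?_⟩
  have := T.toContinuousLinearMap.le_opNorm x
  rw [LinearMap.coe_toContinuousLinearMap'] at this
  nlinarith [norm_nonneg x]

theorem exists_pos_forall_le_norm_apply_of_mem_orthogonal_ker :
    ∃ c : ℝ, 0 < c ∧ ∀ x ∈ (LinearMap.ker T)ᗮ, c * ‖x‖ ≤ ‖T x‖ := by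
  have hker : LinearMap.ker (T.domRestrict (LinearMap.ker T)ᗮ) = ⊥ := by
    refine LinearMap.ker_eq_bot'.2 fun x hx => Subtype.ext ?_
    have h1 : (x : E) ∈ LinearMap.ker T := hx
    exact Submodule.disjoint_def.1 (LinearMap.ker T).orthogonal_disjoint _ h1 x.2
  obtain ⟨C, hC, h⟩ := LinearMap.exists_antilipschitzWith _ hker
  refine ⟨(C : ℝ)⁻¹, by positivity, fun x hx => ?_⟩
  have := h.le_mul_dist ⟨x, hx⟩ 0
  rw [map_zero, dist_zero_right, dist_zero_right] at this
  rw [inv_mul_le_iff₀ (by positivity)]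
  exact this

end Bounds

/-! ### Min-max estimates for singular values. -/

section SingularValueBounds

variable {E F : Type*} [NormedAddCommGroup E] [InnerProductSpace ℂ E] [FiniteDimensional ℂ E]
  [NormedAddCommGroup F] [InnerProductSpace ℂ F] [FiniteDimensional ℂ F] (T : E →ₗ[ℂ] F)

/-- An orthonormal basis of right singular vectors. -/
noncomputable def singularBasis : OrthonormalBasis (Fin (finrank ℂ E)) ℂ E :=
  T.isSymmetric_adjoint_comp_self.eigenvectorBasis rfl

theorem norm_apply_sq_eq_sum (x : E) :
    ‖T x‖ ^ 2 = ∑ i : Fin (finrank ℂ E), T.singularValues i ^ 2 * ‖(singularBasis T).repr x i‖ ^ 2 := by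
  have h1 : (‖T x‖ ^ 2 : ℝ) = RCLike.re (inner ℂ x (LinearMap.adjoint T (T x))) := by
    rw [LinearMap.adjoint_inner_right, inner_self_eq_norm_sq]
  rw [h1, ← (singularBasis T).repr.inner_map_map, PiLp.inner_apply, map_sum]
  refine Finset.sum_congr rfl fun i _ => ?_
  have h2 : (singularBasis T).repr (LinearMap.adjoint T (T x)) i =
      (T.singularValues i ^ 2 : ℝ) * (singularBasis T).repr x i := by
    rw [T.sq_singularValues_fin rfl]
    exact T.isSymmetric_adjoint_comp_self.eigenvectorBasis_apply_self_apply rfl x i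
  rw [h2, ← smul_eq_mul, inner_smul_right, RCLike.re_eq_complex_re, Complex.re_ofReal_mul,
    ← RCLike.re_eq_complex_re, inner_self_eq_norm_sq]

theorem norm_sq_eq_sum_singularBasis (x : E) :
    ‖x‖ ^ 2 = ∑ i, ‖(singularBasis T).repr x i‖ ^ 2 := by
  rw [← (singularBasis T).repr.norm_map x, EuclideanSpace.norm_sq_eq]

/-- In a subspace of sufficiently large dimension there is a nonzero vector whose components in a
set `s` of right singular directions vanish. -/
theorem exists_mem_repr_eq_zero (V : Submodule ℂ E) (s : Finset (Fin (finrank ℂ E)))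
    (hs : s.card < finrank ℂ V) :
    ∃ x ∈ V, x ≠ 0 ∧ ∀ i ∈ s, (singularBasis T).repr x i = 0 := by
  let f : V →ₗ[ℂ] (s → ℂ) :=
    { toFun := fun x i => (singularBasis T).repr x i
      map_add' := fun x y => by ext i; simp
      map_smul' := fun c x => by ext i; simp }
  have hker := LinearMap.ker_ne_bot_of_finrank_lt (f := f) (by simpa using hs)
  obtain ⟨x, hx, hx0⟩ := (Submodule.ne_bot_iff _).1 hker
  refine ⟨x, x.2, fun h => hx0 (Subtype.ext h), fun i hi => ?_⟩
  exact congrFun (LinearMap.mem_ker.1 hx) ⟨i, hi⟩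

/-- One half of Courant–Fischer: by dimension count V contains a nonzero vector without components
along the first j singular directions, and T stretches it by at most the singular value of index j.
-/
theorem le_singularValues_of_forall_le {V : Submodule ℂ E} {j : ℕ} (hj : j < finrank ℂ V) {c : ℝ}
    (h : ∀ x ∈ V, c * ‖x‖ ≤ ‖T x‖) : c ≤ T.singularValues j := by
  have hjn : j < finrank ℂ E := hj.trans_le V.finrank_le
  obtain ⟨x, hxV, hx0, hx⟩ := exists_mem_repr_eq_zero T V (Finset.univ.filter fun i => (i : ℕ) < j)
    (by
      rw [Fin.card_filter_val_lt]
      exact (min_le_right _ _).trans_lt hj)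
  have hle : ‖T x‖ ^ 2 ≤ (T.singularValues j * ‖x‖) ^ 2 := by
    rw [norm_apply_sq_eq_sum, mul_pow, norm_sq_eq_sum_singularBasis T x, Finset.mul_sum]
    refine Finset.sum_le_sum fun i _ => ?_
    by_cases hi : (i : ℕ) < j
    · rw [hx i (by simpa using hi)]
      simp
    · have := T.singularValues_antitone (not_lt.1 hi)
      have := T.singularValues_nonneg i
      gcongr
  have := (h x hxV).trans (le_of_sq_le_sq hle (mul_nonneg (T.singularValues_nonneg j)
    (norm_nonneg x)))
  exact le_of_mul_le_mul_right this (norm_pos_iff.2 hx0)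

theorem singularValues_le_of_forall_le {V : Submodule ℂ E} {j : ℕ}
    (hj : finrank ℂ E ≤ finrank ℂ V + j) {c : ℝ} (hc : 0 ≤ c)
    (h : ∀ x ∈ V, ‖T x‖ ≤ c * ‖x‖) : T.singularValues j ≤ c := by
  by_cases hjn : j < finrank ℂ E
  · obtain ⟨x, hxV, hx0, hx⟩ := exists_mem_repr_eq_zero T V (Finset.Ioi ⟨j, hjn⟩)
      (by
        rw [Fin.card_Ioi]
        dsimp only
        omega)
    have hle : (T.singularValues j * ‖x‖) ^ 2 ≤ ‖T x‖ ^ 2 := by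
      rw [norm_apply_sq_eq_sum, mul_pow, norm_sq_eq_sum_singularBasis T x, Finset.mul_sum]
      refine Finset.sum_le_sum fun i _ => ?_
      by_cases hi : j < i
      · rw [hx i (by simpa [Fin.lt_def] using hi)]
        simp
      · have := T.singularValues_antitone (not_lt.1 hi)
        have := T.singularValues_nonneg j
        gcongr
    have := (le_of_sq_le_sq hle (norm_nonneg _)).trans (h x hxV)
    exact le_of_mul_le_mul_right this (norm_pos_iff.2 hx0)
  · rw [T.singularValues_of_finrank_le (not_lt.1 hjn)]
    exact hc

theorem singularValues_mul_norm_le (x : E) :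
    T.singularValues (finrank ℂ E - 1) * ‖x‖ ≤ ‖T x‖ := by
  refine le_of_sq_le_sq ?_ (norm_nonneg _)
  rw [norm_apply_sq_eq_sum, mul_pow, norm_sq_eq_sum_singularBasis T x, Finset.mul_sum]
  refine Finset.sum_le_sum fun i _ => ?_
  have := T.singularValues_antitone (show (i : ℕ) ≤ finrank ℂ E - 1 by omega)
  have := T.singularValues_nonneg (finrank ℂ E - 1)
  gcongr

end SingularValueBounds

/-! ### Orders of singular values and lower bounds. -/

section Perturbation

variable {E F : Type*} [NormedAddCommGroup E] [InnerProductSpace ℂ E] [FiniteDimensional ℂ E]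
  [NormedAddCommGroup F] [InnerProductSpace ℂ F] [FiniteDimensional ℂ F]

/-- If `T₀ - w S` is bounded below by a multiple of `|ε|`, where `|w| = |ε|`, then its singular
values are of order `0` or `1` in `ε`. -/
theorem exists_isTheta_singularValues {T₀ S : E →ₗ[ℂ] F} {w : ℝ → ℂ} (hw : ∀ ε, ‖w ε‖ = |ε|)
    {c : ℝ} (hc : 0 < c)
    (h : ∀ᶠ ε in 𝓝[≠] (0 : ℝ), ∀ x, c * |ε| * ‖x‖ ≤ ‖(T₀ - w ε • S) x‖)
    {j : ℕ} (hj : j < finrank ℂ E) :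
    ∃ p ∈ ({0, 1} : Set ℕ), Asymptotics.IsTheta (𝓝[≠] (0 : ℝ))
      (fun ε => (T₀ - w ε • S).singularValues j) (fun ε => |ε| ^ p) := by
  obtain ⟨C₀, hC₀, hT₀⟩ := exists_pos_forall_norm_apply_le T₀
  obtain ⟨C, hC, hS⟩ := exists_pos_forall_norm_apply_le S
  have happ : ∀ ε x, (T₀ - w ε • S) x = T₀ x - w ε • S x := fun ε x => rfl
  have hwS : ∀ ε x, ‖w ε • S x‖ ≤ |ε| * C * ‖x‖ := fun ε x => by
    rw [norm_smul, hw, mul_assoc]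
    exact mul_le_mul_of_nonneg_left (hS x) (abs_nonneg ε)
  have hsmall : ∀ δ : ℝ, 0 < δ → ∀ᶠ ε in 𝓝[≠] (0 : ℝ), |ε| ≤ δ := fun δ hδ =>
    eventually_nhdsWithin_of_eventually_nhds
      ((continuous_abs.tendsto' (0 : ℝ) 0 abs_zero).eventually (Iic_mem_nhds hδ))
  -- The exponent is decided by the rank of T₀, the dimension of the orthogonal complement of its
  -- kernel: order 0 below it, order 1 from it on.
  by_cases hjr : j < finrank ℂ (LinearMap.ker T₀)ᗮ
  · obtain ⟨c₀, hc₀, hlow⟩ := exists_pos_forall_le_norm_apply_of_mem_orthogonal_ker T₀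
    refine ⟨0, by simp, ?_, ?_⟩
    · refine Asymptotics.IsBigO.of_bound (C₀ + C) ?_
      filter_upwards [hsmall 1 one_pos] with ε hε
      rw [Real.norm_of_nonneg (LinearMap.singularValues_nonneg _ _), pow_zero, norm_one, mul_one]
      refine singularValues_le_of_forall_le _ (V := ⊤) (by simp) (by positivity) fun x _ => ?_
      rw [happ]
      refine (norm_sub_le _ _).trans ?_
      rw [add_mul]
      refine add_le_add (hT₀ x) ((hwS ε x).trans ?_)
      gcongr
      nlinarith
    · refine Asymptotics.IsBigO.of_bound (2 / c₀) ?_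
      -- For such ε the perturbation consumes at most half of the lower bound c₀ of T₀ on the
      -- complement of its kernel.
      filter_upwards [hsmall (c₀ / (2 * C)) (by positivity)] with ε hε
      rw [Real.norm_of_nonneg (LinearMap.singularValues_nonneg _ _), pow_zero, norm_one]
      rw [div_mul_eq_mul_div, le_div_iff₀ hc₀, one_mul, ← div_le_iff₀' two_pos]
      refine le_singularValues_of_forall_le _ hjr fun x hx => ?_
      have h1 := hlow x hx
      have h2 : |ε| * C ≤ c₀ / 2 := by
        rw [le_div_iff₀ (by positivity)] at hε
        linarith
      have h3 : ‖w ε • S x‖ ≤ c₀ / 2 * ‖x‖ := (hwS ε x).trans (by gcongr)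
      rw [happ]
      have h4 := norm_sub_norm_le (T₀ x) (w ε • S x)
      linarith
  · refine ⟨1, by simp, ?_, ?_⟩
    · refine Asymptotics.IsBigO.of_bound C (Eventually.of_forall fun ε => ?_)
      rw [Real.norm_of_nonneg (LinearMap.singularValues_nonneg _ _), pow_one, norm_abs_eq_norm,
        Real.norm_eq_abs]
      refine singularValues_le_of_forall_le _ (V := LinearMap.ker T₀) ?_ (by positivity)
        fun x hx => ?_
      · have := (LinearMap.ker T₀).finrank_add_finrank_orthogonal
        omega
      · rw [happ, LinearMap.mem_ker.1 hx, zero_sub, norm_neg, mul_comm C]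
        exact hwS ε x
    · refine Asymptotics.IsBigO.of_bound c⁻¹ ?_
      filter_upwards [h] with ε hε
      rw [Real.norm_of_nonneg (LinearMap.singularValues_nonneg _ _), pow_one, norm_abs_eq_norm,
        Real.norm_eq_abs, le_inv_mul_iff₀ hc]
      exact le_singularValues_of_forall_le _ (V := ⊤) (by simpa using hj) fun x _ => hε x

theorem exists_forall_le_norm_of_isTheta_singularValues {T : ℝ → E →ₗ[ℂ] F}
    (h : ∀ j < finrank ℂ E, ∃ p ∈ ({0, 1} : Set ℕ), Asymptotics.IsTheta (𝓝[≠] (0 : ℝ))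
      (fun ε => (T ε).singularValues j) (fun ε => |ε| ^ p)) :
    ∃ c : ℝ, 0 < c ∧ ∀ᶠ ε in 𝓝[≠] (0 : ℝ), ∀ x, c * |ε| * ‖x‖ ≤ ‖T ε x‖ := by
  rcases Nat.eq_zero_or_pos (finrank ℂ E) with h0 | hpos
  · have : Subsingleton E := finrank_zero_iff.1 h0
    refine ⟨1, one_pos, Eventually.of_forall fun ε x => ?_⟩
    rw [Subsingleton.elim x 0]
    simp
  · obtain ⟨p, hp, hθ⟩ := h (finrank ℂ E - 1) (by omega)
    obtain ⟨C, hC, hb⟩ := hθ.2.exists_pos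
    refine ⟨C⁻¹, by positivity, ?_⟩
    have hsmall : ∀ᶠ ε in 𝓝[≠] (0 : ℝ), |ε| ≤ 1 := eventually_nhdsWithin_of_eventually_nhds
      ((continuous_abs.tendsto' (0 : ℝ) 0 abs_zero).eventually (Iic_mem_nhds one_pos))
    filter_upwards [hb.bound, hsmall] with ε hε hε1 x
    refine le_trans ?_ (singularValues_mul_norm_le (T ε) x)
    gcongr
    rw [Real.norm_of_nonneg (LinearMap.singularValues_nonneg _ _), norm_pow,
      norm_abs_eq_norm, Real.norm_eq_abs] at hε
    rw [inv_mul_le_iff₀ hC]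
    refine le_trans ?_ hε
    rcases hp with rfl | rfl
    · simpa using hε1
    · simp

end Perturbation

/-! ### Lower bounds, Jordan chains and diagonal reductions. -/

section LowerBound

variable {E F : Type*} [NormedAddCommGroup E] [InnerProductSpace ℂ E]
  [NormedAddCommGroup F] [InnerProductSpace ℂ F]

/-- A Jordan chain of length two is not compatible with a lower bound of order `|ε|`. -/
theorem eq_zero_of_forall_le_norm {T₀ S : E →ₗ[ℂ] F} {c : ℝ} (hc : 0 < c)
    (h : ∀ᶠ ε : ℝ in 𝓝[≠] 0, ∀ x, c * |ε| * ‖x‖ ≤ ‖(T₀ - (ε : ℂ) • S) x‖)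
    {φ ψ : E} (h1 : T₀ φ = 0) (h2 : S φ = T₀ ψ) : φ = 0 := by
  -- On the test vector φ + εψ the first two orders in ε cancel and leave -ε² Sψ. Dividing the bound
  -- by |ε| and letting ε → 0 gives φ = 0.
  have hb : ∀ᶠ ε : ℝ in 𝓝[≠] (0 : ℝ), c * ‖φ + (ε : ℂ) • ψ‖ ≤ |ε| * ‖S ψ‖ := by
    filter_upwards [h, self_mem_nhdsWithin] with ε hε hε0
    have hpos : 0 < |ε| := abs_pos.2 hε0
    have := hε (φ + (ε : ℂ) • ψ)
    have h3 : (T₀ - (ε : ℂ) • S) (φ + (ε : ℂ) • ψ) = -((ε : ℂ) • (ε : ℂ) • S ψ) := by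
      simp only [LinearMap.sub_apply, LinearMap.smul_apply, map_add, map_smul, h1, h2]
      rw [smul_sub]
      abel
    rw [h3, norm_neg, norm_smul, norm_smul, Complex.norm_real, Real.norm_eq_abs] at this
    refine le_of_mul_le_mul_left ?_ hpos
    linarith
  have hl : Tendsto (fun ε : ℝ => c * ‖φ + (ε : ℂ) • ψ‖) (𝓝[≠] 0) (𝓝 (c * ‖φ‖)) := by
    refine (Continuous.tendsto' ?_ 0 _ (by simp)).mono_left nhdsWithin_le_nhds
    fun_prop
  have hr : Tendsto (fun ε : ℝ => |ε| * ‖S ψ‖) (𝓝[≠] 0) (𝓝 0) := by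
    refine (Continuous.tendsto' ?_ 0 _ (by simp)).mono_left nhdsWithin_le_nhds
    fun_prop
  have := le_of_tendsto_of_tendsto hl hr hb
  by_contra hne
  have := mul_pos hc (norm_pos_iff.2 hne)
  linarith

/-- The lower bound for a pencil that is diagonalized by a left factor `G`. -/
theorem exists_forall_le_norm_of_diagonal [FiniteDimensional ℂ F] {n : Type*} [Fintype n] {N K : E →ₗ[ℂ] F}
    (G : F →ₗ[ℂ] (n → ℂ)) (Y : E ≃ₗ[ℂ] (n → ℂ)) (D : n → ℂ) (hN : ∀ x, G (N x) = Y x)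
    (hK : ∀ x, G (K x) = D * Y x) (z : ℂ) {w : ℝ → ℂ} (hw : ∀ ε, ‖w ε‖ = |ε|) :
    ∃ c : ℝ, 0 < c ∧ ∀ᶠ ε in 𝓝[≠] (0 : ℝ), ∀ x, c * |ε| * ‖x‖ ≤ ‖((K - z • N) - w ε • N) x‖ := by
  have hG : ∃ C : ℝ, 0 < C ∧ ∀ x, ‖G x‖ ≤ C * ‖x‖ := by
    refine ⟨‖G.toContinuousLinearMap‖ + 1, by positivity, fun x => ?_⟩
    have := G.toContinuousLinearMap.le_opNorm x
    rw [LinearMap.coe_toContinuousLinearMap'] at this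
    nlinarith [norm_nonneg x]
  have hE : FiniteDimensional ℂ E := Y.symm.finiteDimensional
  have hY : ∃ C : ℝ, 0 < C ∧ ∀ x, ‖x‖ ≤ C * ‖Y x‖ := by
    refine ⟨‖Y.symm.toLinearMap.toContinuousLinearMap‖ + 1, by positivity, fun x => ?_⟩
    have := Y.symm.toLinearMap.toContinuousLinearMap.le_opNorm (Y x)
    rw [LinearMap.coe_toContinuousLinearMap', LinearEquiv.coe_coe, Y.symm_apply_apply] at this
    nlinarith [norm_nonneg (Y x)]
  obtain ⟨C₁, hC₁, hG⟩ := hG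
  obtain ⟨C₂, hC₂, hY⟩ := hY
  refine ⟨(C₁ * C₂)⁻¹, by positivity, ?_⟩
  -- Diagonal entries with D i = z contribute exactly |ε|; the others stay away from 0 by at least
  -- |D i - z|/2.
  have hD : ∀ᶠ ε in 𝓝[≠] (0 : ℝ), ∀ i, |ε| ≤ ‖D i - z - w ε‖ := by
    refine eventually_all.2 fun i => ?_
    by_cases hi : D i - z = 0
    · exact Eventually.of_forall fun ε => by rw [hi, zero_sub, norm_neg, hw]
    · have hpos : 0 < ‖D i - z‖ / 2 := by positivity
      filter_upwards [eventually_nhdsWithin_of_eventually_nhds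
        ((continuous_abs.tendsto' (0 : ℝ) 0 abs_zero).eventually (Iic_mem_nhds hpos))] with ε hε
      have := norm_sub_norm_le (D i - z) (w ε)
      rw [hw] at this
      have hε : |ε| ≤ ‖D i - z‖ / 2 := hε
      linarith
  filter_upwards [hD] with ε hε x
  have hGx : G (((K - z • N) - w ε • N) x) = fun i => (D i - z - w ε) * Y x i := by
    simp only [LinearMap.sub_apply, LinearMap.smul_apply, map_sub, map_smul, hN, hK]
    funext i
    simp only [Pi.sub_apply, Pi.mul_apply, Pi.smul_apply, smul_eq_mul]
    ring
  have h1 : |ε| * ‖Y x‖ ≤ C₁ * ‖((K - z • N) - w ε • N) x‖ := by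
    refine le_trans ?_ (hG _)
    rw [← Real.norm_of_nonneg (abs_nonneg ε), ← norm_smul,
      pi_norm_le_iff_of_nonneg (norm_nonneg _)]
    intro i
    refine le_trans ?_ (norm_le_pi_norm _ i)
    rw [hGx, Pi.smul_apply, norm_smul, norm_mul, Real.norm_of_nonneg (abs_nonneg ε)]
    exact mul_le_mul_of_nonneg_right (hε i) (norm_nonneg _)
  rw [mul_assoc, inv_mul_le_iff₀ (by positivity)]
  calc |ε| * ‖x‖ ≤ |ε| * (C₂ * ‖Y x‖) := mul_le_mul_of_nonneg_left (hY x) (abs_nonneg ε)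
    _ = C₂ * (|ε| * ‖Y x‖) := by ring
    _ ≤ C₂ * (C₁ * ‖((K - z • N) - w ε • N) x‖) := by gcongr
    _ = _ := by ring

end LowerBound

end

section

open Matrix Module

/-! ### Orthonormal kernel bases and the matrix X N Q. -/

section KernelBases

variable {e u : ℕ}

theorem exists_isRightKernelBasis (M : Matrix (Fin e) (Fin u) ℂ) {G : Matrix (Fin u) (Fin u) ℂ}
    (hG : G.PosDef) : ∃ (r : ℕ) (Q : Matrix (Fin u) (Fin r) ℂ), IsRightKernelBasis M G Q := by
  obtain ⟨B, hB, rfl⟩ := exists_isUnit_conjTranspose_mul_self hG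
  have hBd := (Matrix.isUnit_iff_isUnit_det _).1 hB
  have hB1 : B⁻¹ * B = 1 := Matrix.nonsing_inv_mul _ hBd
  have hB2 : B * B⁻¹ = 1 := Matrix.mul_nonsing_inv _ hBd
  set V := LinearMap.ker (Matrix.toEuclideanLin (M * B⁻¹)) with hV
  set b := stdOrthonormalBasis ℂ V
  set O : Matrix (Fin u) (Fin (finrank ℂ V)) ℂ := Matrix.of fun i j => (b j : EuclideanSpace ℂ _) i
    with hO
  -- With G = Bᴴ B, the substitution φ = B⁻¹v turns G-orthonormality into standard orthonormality in
  -- the kernel of M B⁻¹.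
  have hker : M * B⁻¹ * O = 0 := by
    ext i j
    have := LinearMap.mem_ker.1 (b j).2
    exact congrArg (fun v : EuclideanSpace ℂ (Fin e) => v i) this
  have hOO : Oᴴ * O = 1 := by
    ext i j
    have := orthonormal_iff_ite.1 b.orthonormal i j
    rw [Submodule.coe_inner, PiLp.inner_apply] at this
    rw [Matrix.one_apply, ← this]
    simp [Matrix.mul_apply, hO, mul_comm]
  refine ⟨finrank ℂ V, B⁻¹ * O, ?_, ?_, ?_⟩
  · rw [← Matrix.mul_assoc, hker]
  · rw [Matrix.conjTranspose_mul]
    calc Oᴴ * (B⁻¹)ᴴ * (Bᴴ * B) * (B⁻¹ * O) = Oᴴ * ((B * B⁻¹)ᴴ * (B * B⁻¹)) * O := by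
          rw [Matrix.conjTranspose_mul]
          simp only [Matrix.mul_assoc]
      _ = 1 := by rw [hB2, Matrix.conjTranspose_one, Matrix.one_mul, Matrix.mul_one, hOO]
  · intro φ hφ
    have hmem : WithLp.toLp 2 (B *ᵥ φ) ∈ V := by
      rw [hV, LinearMap.mem_ker, Matrix.toLpLin_toLp, Matrix.toLin'_apply,
        Matrix.mulVec_mulVec, Matrix.mul_assoc, hB1,
        Matrix.mul_one, hφ]
      rfl
    refine ⟨b.repr ⟨_, hmem⟩, ?_⟩
    have hsum := congrArg (fun v : V => (v : EuclideanSpace ℂ (Fin u))) (b.sum_repr ⟨_, hmem⟩)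
    have h1 : O *ᵥ (b.repr ⟨_, hmem⟩) = B *ᵥ φ := by
      funext i
      have := congrArg (fun v : EuclideanSpace ℂ (Fin u) => v i) hsum
      simp only [Submodule.coe_sum, Submodule.coe_smul, WithLp.ofLp_sum, Finset.sum_apply,
        WithLp.ofLp_smul, Pi.smul_apply, smul_eq_mul] at this
      rw [← this, Matrix.mulVec_apply_eq_sum]
      exact Finset.sum_congr rfl fun j _ => mul_comm _ _
    rw [← Matrix.mulVec_mulVec, h1, Matrix.mulVec_mulVec, hB1, Matrix.one_mulVec]

theorem exists_isLeftKernelBasis (M : Matrix (Fin e) (Fin u) ℂ) {G : Matrix (Fin e) (Fin e) ℂ}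
    (hG : G.PosDef) : ∃ (q : ℕ) (X : Matrix (Fin q) (Fin e) ℂ), IsLeftKernelBasis M G X := by
  obtain ⟨q, Q, h1, h2, h3⟩ := exists_isRightKernelBasis Mᴴ hG.inv
  refine ⟨q, Qᴴ, ?_, ?_, ?_⟩
  · rw [← Matrix.conjTranspose_conjTranspose M, ← Matrix.conjTranspose_mul, h1,
      Matrix.conjTranspose_zero]
  · rwa [Matrix.conjTranspose_conjTranspose]
  · intro x hx
    obtain ⟨c, hc⟩ := h3 (star x) (by rw [← Matrix.star_vecMul, hx, star_zero])
    refine ⟨star c, ?_⟩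
    rw [← Matrix.star_mulVec, ← hc, star_star]

theorem IsRightKernelBasis.mulVec_mem {r : ℕ} {M : Matrix (Fin e) (Fin u) ℂ}
    {G : Matrix (Fin u) (Fin u) ℂ} {Q : Matrix (Fin u) (Fin r) ℂ} (h : IsRightKernelBasis M G Q)
    (c : Fin r → ℂ) : M *ᵥ Q *ᵥ c = 0 := by
  rw [Matrix.mulVec_mulVec, h.mul_eq_zero, Matrix.zero_mulVec]

theorem IsRightKernelBasis.eq_zero_of_mulVec_eq_zero {r : ℕ} {M : Matrix (Fin e) (Fin u) ℂ}
    {G : Matrix (Fin u) (Fin u) ℂ} {Q : Matrix (Fin u) (Fin r) ℂ} (h : IsRightKernelBasis M G Q)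
    {c : Fin r → ℂ} (hc : Q *ᵥ c = 0) : c = 0 := by
  rw [← Matrix.one_mulVec c, ← h.orthonormal, ← Matrix.mulVec_mulVec, hc, Matrix.mulVec_zero]

/-- The rows of X span all left null vectors, so X detects exactly the range of M. -/
theorem IsLeftKernelBasis.exists_mulVec_eq {q : ℕ} {M : Matrix (Fin e) (Fin u) ℂ}
    {G : Matrix (Fin e) (Fin e) ℂ} {X : Matrix (Fin q) (Fin e) ℂ} (h : IsLeftKernelBasis M G X)
    {y : Fin e → ℂ} (hy : X *ᵥ y = 0) : ∃ ψ, M *ᵥ ψ = y := by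
  apply exists_mulVec_eq_of_forall_vecMul_eq_zero
  intro x hx
  obtain ⟨c, rfl⟩ := h.spans x hx
  rw [← Matrix.dotProduct_mulVec, hy, dotProduct_zero]

theorem forall_singularValues_pos_iff {q r : ℕ} (R : Matrix (Fin q) (Fin r) ℂ) :
    (∀ j < r, 0 < (Matrix.toEuclideanLin R).singularValues j) ↔ ∀ c, R *ᵥ c = 0 → c = 0 := by
  have h := (Matrix.toEuclideanLin R).injective_iff_forall_lt_finrank_singularValues_pos
  rw [finrank_euclideanSpace_fin] at h
  rw [← h, ← LinearMap.ker_eq_bot, LinearMap.ker_eq_bot']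
  constructor
  · intro h c hc
    have := h (WithLp.toLp 2 c) (by rw [Matrix.toLpLin_toLp, Matrix.toLin'_apply, hc]; rfl)
    simpa using this
  · intro h c hc
    have := h c.ofLp (congrArg WithLp.ofLp hc)
    exact congrArg (WithLp.toLp 2) this

/-- The singular values of the matrix `X N Q` formed with kernel bases of `M` are positive if and
only if `N` maps no nonzero vector of the kernel of `M` into the range of `M`. -/
theorem forall_kernelBasis_singularValues_pos_iff (M N : Matrix (Fin e) (Fin u) ℂ)
    {GΨ : Matrix (Fin e) (Fin e) ℂ} (hΨ : GΨ.PosDef) {GΦ : Matrix (Fin u) (Fin u) ℂ}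
    (hΦ : GΦ.PosDef) :
    (∀ (q r : ℕ) (X : Matrix (Fin q) (Fin e) ℂ) (Q : Matrix (Fin u) (Fin r) ℂ),
      IsLeftKernelBasis M GΨ X → IsRightKernelBasis M GΦ Q →
      ∀ j < r, 0 < (Matrix.toEuclideanLin (X * N * Q)).singularValues j) ↔
    ∀ φ ψ, M *ᵥ φ = 0 → N *ᵥ φ = M *ᵥ ψ → φ = 0 := by
  constructor
  · intro h φ ψ h1 h2
    obtain ⟨r, Q, hQ⟩ := exists_isRightKernelBasis M hΦ
    obtain ⟨q, X, hX⟩ := exists_isLeftKernelBasis M hΨ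
    obtain ⟨c, rfl⟩ := hQ.spans φ h1
    rw [(forall_singularValues_pos_iff _).1 (h q r X Q hX hQ) c, Matrix.mulVec_zero]
    rw [← Matrix.mulVec_mulVec, ← Matrix.mulVec_mulVec, h2, Matrix.mulVec_mulVec, hX.mul_eq_zero,
      Matrix.zero_mulVec]
  · intro h q r X Q hX hQ
    rw [forall_singularValues_pos_iff]
    intro c hc
    rw [← Matrix.mulVec_mulVec, ← Matrix.mulVec_mulVec] at hc
    obtain ⟨ψ, hψ⟩ := hX.exists_mulVec_eq hc
    exact hQ.eq_zero_of_mulVec_eq_zero (h _ ψ (hQ.mulVec_mem c) hψ.symm)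

end KernelBases

end

section

open Matrix Module

/-! ### The symbol along a line as a matrix pencil. -/

section SymbolLemmas

variable {𝕜 : Type*} [RCLike 𝕜] {d e u : ℕ} (𝔑 : Fin (d + 1) → Matrix (Fin e) (Fin u) 𝕜)

/-- The complexification of the symbol at a real covector. -/
noncomputable def realSymbol (l : Fin (d + 1) → ℝ) : Matrix (Fin e) (Fin u) ℂ :=
  (symbol 𝔑 l).map (complexHom 𝕜)

theorem complexSymbol_ofReal (l : Fin (d + 1) → ℝ) :
    complexSymbol 𝔑 (fun a => (l a : ℂ)) = realSymbol 𝔑 l := by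
  ext i j
  simp only [complexSymbol, realSymbol, symbol, Matrix.sum_apply, Matrix.smul_apply,
    Matrix.map_apply, map_sum, smul_eq_mul, ← coe_complexHom]
  refine Finset.sum_congr rfl fun a _ => ?_
  rw [RCLike.real_smul_eq_coe_mul, map_mul, complexHom_ofReal]

theorem complexSymbol_add (l l' : Fin (d + 1) → ℂ) :
    complexSymbol 𝔑 (l + l') = complexSymbol 𝔑 l + complexSymbol 𝔑 l' := by
  simp only [complexSymbol, Pi.add_apply, add_smul, Finset.sum_add_distrib]

theorem complexSymbol_smul (c : ℂ) (l : Fin (d + 1) → ℂ) :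
    complexSymbol 𝔑 (c • l) = c • complexSymbol 𝔑 l := by
  simp only [complexSymbol, Pi.smul_apply, smul_eq_mul, mul_smul, Finset.smul_sum]

theorem complexSymbol_line (n k : Fin (d + 1) → ℝ) (z : ℂ) :
    complexSymbol 𝔑 (line n k z) = realSymbol 𝔑 k - z • realSymbol 𝔑 n := by
  rw [← complexSymbol_ofReal, ← complexSymbol_ofReal, sub_eq_add_neg, ← neg_smul,
    ← complexSymbol_smul, ← complexSymbol_add]
  congr 1
  funext a
  simp [line]
  ring

theorem complexSymbol_extendedLine (n k : Fin (d + 1) → ℝ) (z : ℂ) (ε θ : ℝ) :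
    complexSymbol 𝔑 (extendedLine n k z ε θ) = realSymbol 𝔑 k - z • realSymbol 𝔑 n -
      ((ε : ℂ) * Complex.exp (Complex.I * θ)) • realSymbol 𝔑 n := by
  rw [← complexSymbol_line, ← complexSymbol_ofReal, sub_eq_add_neg, ← neg_smul,
    ← complexSymbol_smul, ← complexSymbol_add]
  congr 1
  funext a
  simp [extendedLine]
  ring

theorem symbol_smul (c : ℝ) (l : Fin (d + 1) → ℝ) : symbol 𝔑 (c • l) = c • symbol 𝔑 l := by
  simp only [symbol, Pi.smul_apply, smul_eq_mul, mul_smul, Finset.smul_sum]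

variable {𝔑} {n k : Fin (d + 1) → ℝ}

theorem IsHyperbolic.eq_zero (hyp : IsHyperbolic 𝔑 n) (φ : Fin u → ℂ)
    (h : realSymbol 𝔑 n *ᵥ φ = 0) : φ = 0 :=
  hyp.ker_eq_bot φ (by rwa [complexSymbol_ofReal])

theorem IsHyperbolic.im_eq_zero (hyp : IsHyperbolic 𝔑 n) (hk : Transverse n k) (z : ℂ)
    (φ : Fin u → ℂ) (hφ : φ ≠ 0) (h : realSymbol 𝔑 k *ᵥ φ = z • realSymbol 𝔑 n *ᵥ φ) :
    z.im = 0 := by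
  refine hyp.real_of_ker k hk z ⟨φ, hφ, ?_⟩
  rw [complexSymbol_line, Matrix.sub_mulVec, Matrix.smul_mulVec, h, sub_self]

end SymbolLemmas

/-! ### Reductions, Kronecker form and kernel condition of a hyperbolic system. -/

section Reductions

variable {𝕜 : Type*} [RCLike 𝕜] {d e u : ℕ} {𝔑 : Fin (d + 1) → Matrix (Fin e) (Fin u) 𝕜}
  {n k : Fin (d + 1) → ℝ}

/-- A left inverse of `N` which reduces the pencil to a matrix with given diagonal form. -/
theorem exists_leftInverse_of_diagonalizable {N K : Matrix (Fin e) (Fin u) 𝕜}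
    {M : Matrix (Fin u) (Fin e) 𝕜} (hM : IsUnit (M * N))
    (hA : Diagonalizable ((M * N)⁻¹ * (M * K))) :
    ∃ (L : Matrix (Fin u) (Fin e) ℂ) (S : Matrix (Fin u) (Fin u) ℂ) (D : Fin u → ℂ),
      L * N.map (complexHom 𝕜) = 1 ∧ IsUnit S ∧
      L * K.map (complexHom 𝕜) = S * diagonal D * S⁻¹ := by
  obtain ⟨S, D, hS, hSD⟩ := hA
  refine ⟨((M * N)⁻¹ * M).map (complexHom 𝕜), S, D, ?_, hS, ?_⟩
  · rw [← map_complexHom_mul, Matrix.mul_assoc,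
      Matrix.nonsing_inv_mul _ ((Matrix.isUnit_iff_isUnit_det _).1 hM),
      Matrix.map_one _ (map_zero _) (map_one _)]
  · rw [← map_complexHom_mul, Matrix.mul_assoc, ← hSD]
    rfl

theorem hasNoChain_of_diagonalizable {h : (Fin (d + 1) → ℝ) → Matrix (Fin u) (Fin e) 𝕜}
    (hk : Transverse n k) (hh : IsReduction 𝔑 n h)
    (hA : Diagonalizable (reducedMatrix 𝔑 n h k)) :
    HasNoChain (realSymbol 𝔑 n) (realSymbol 𝔑 k) := by
  obtain ⟨L, S, D, hL, hS, hSD⟩ := exists_leftInverse_of_diagonalizable (hh.isUnit k hk) hA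
  exact HasNoChain.of_diagonal hL hS hSD

theorem Hermitizable.smul {A : Matrix (Fin u) (Fin u) 𝕜} (hA : Hermitizable A) (c : ℝ) :
    Hermitizable (c • A) := by
  obtain ⟨H, hH, hHA⟩ := hA
  refine ⟨H, hH, ?_⟩
  rw [Matrix.mul_smul]
  rw [Matrix.IsHermitian, Matrix.conjTranspose_smul, hHA.eq, star_trivial]

/-- Reductions chosen on each line through the origin form a homogeneous reduction. -/
theorem exists_isReduction_forall_hermitizable
    (hex : ∀ k, Transverse n k → ∃ M : Matrix (Fin u) (Fin e) 𝕜, IsUnit (M * symbol 𝔑 n) ∧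
      Hermitizable ((M * symbol 𝔑 n)⁻¹ * (M * symbol 𝔑 k))) :
    ∃ h, IsReduction 𝔑 n h ∧ ∀ k, Transverse n k → Hermitizable (reducedMatrix 𝔑 n h k) := by
  -- Choosing M per line through the origin makes homogeneity automatic. The choice serves every k
  -- on the line because A(ck) = cA(k) is Hermitized by the same H.
  have hV : ∀ V : Submodule ℝ (Fin (d + 1) → ℝ), ∃ M : Matrix (Fin u) (Fin e) 𝕜,
      ∀ k, Transverse n k → Submodule.span ℝ {k} = V → IsUnit (M * symbol 𝔑 n) ∧
        Hermitizable ((M * symbol 𝔑 n)⁻¹ * (M * symbol 𝔑 k)) := by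
    intro V
    by_cases h : ∃ k, Transverse n k ∧ Submodule.span ℝ {k} = V
    · obtain ⟨k, hk, rfl⟩ := h
      obtain ⟨M, hM, hA⟩ := hex k hk
      refine ⟨M, fun k' _ hspan => ⟨hM, ?_⟩⟩
      obtain ⟨c, rfl⟩ := Submodule.mem_span_singleton.1
        (hspan ▸ Submodule.mem_span_singleton_self k')
      rw [symbol_smul, Matrix.mul_smul, Matrix.mul_smul]
      exact hA.smul c
    · exact ⟨0, fun k hk hspan => absurd ⟨k, hk, hspan⟩ h⟩
  choose M hM using hV
  refine ⟨fun k => M (Submodule.span ℝ {k}), ⟨fun k hk => (hM _ k hk rfl).1, ?_⟩,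
    fun k hk => (hM _ k hk rfl).2⟩
  intro k _ c hc
  rw [Submodule.span_singleton_smul_eq (IsUnit.mk0 c hc)]

theorem IsHyperbolic.exists_hermitizable (hyp : IsHyperbolic 𝔑 n) (hk : Transverse n k)
    (h : HasNoChain (realSymbol 𝔑 n) (realSymbol 𝔑 k)) :
    ∃ M : Matrix (Fin u) (Fin e) 𝕜, IsUnit (M * symbol 𝔑 n) ∧
      Hermitizable ((M * symbol 𝔑 n)⁻¹ * (M * symbol 𝔑 k)) :=
  HasNoChain.exists_hermitizable hyp.eq_zero (hyp.im_eq_zero hk) h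

theorem IsHyperbolic.trivialKronecker_iff (hyp : IsHyperbolic 𝔑 n) (hk : Transverse n k) :
    TrivialKronecker (fun z => complexSymbol 𝔑 (line n k z)) ↔
      HasNoChain (realSymbol 𝔑 n) (realSymbol 𝔑 k) := by
  simp only [complexSymbol_line]
  -- Hyperbolicity excludes nonreal eigenvalues, so `Complex.I` is a regular point of the pencil.
  refine FirstOrderSystem.trivialKronecker_iff hyp.eq_zero (z₀ := Complex.I) fun φ hφ => ?_
  by_contra hne
  simpa using hyp.im_eq_zero hk _ φ hne hφ

theorem IsHyperbolic.perturbationCoefficientsPos_iff (hyp : IsHyperbolic 𝔑 n)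
    (hk : Transverse n k) {GΨ : Matrix (Fin e) (Fin e) ℂ} (hΨ : GΨ.PosDef)
    {GΦ : Matrix (Fin u) (Fin u) ℂ} (hΦ : GΦ.PosDef) :
    PerturbationCoefficientsPos 𝔑 GΨ GΦ n k ↔
      HasNoChain (realSymbol 𝔑 n) (realSymbol 𝔑 k) := by
  simp only [PerturbationCoefficientsPos, complexSymbol_line, complexSymbol_ofReal]
  refine (forall_congr' fun z =>
    forall_kernelBasis_singularValues_pos_iff _ _ hΨ hΦ).trans ⟨?_, ?_⟩
  · intro h z φ ψ h1 h2
    by_contra hne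
    have hz : ((z.re : ℝ) : ℂ) = z := Complex.ext (by simp) (by simp [hyp.im_eq_zero hk z φ hne h1])
    refine hne (h z.re φ ψ ?_ ?_)
    · rw [hz, Matrix.sub_mulVec, Matrix.smul_mulVec, h1, sub_self]
    · rw [hz, Matrix.sub_mulVec, Matrix.smul_mulVec, h2]
  · intro h z φ ψ h1 h2
    rw [Matrix.sub_mulVec, Matrix.smul_mulVec] at h1 h2
    exact h z φ ψ (sub_eq_zero.1 h1) h2

end Reductions

/-! ### Singular values with respect to the given Hermitian forms. -/

section FormSpaces

variable {e u : ℕ} {GΨ : Matrix (Fin e) (Fin e) ℂ} (hΨ : GΨ.PosDef)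
  {GΦ : Matrix (Fin u) (Fin u) ℂ} (hΦ : GΦ.PosDef)

/-- The identity map as a linear equivalence to the space of coordinate vectors. -/
noncomputable def formEquiv : FormSpace hΦ ≃ₗ[ℂ] (Fin u → ℂ) where
  toFun x := x
  invFun x := x
  map_add' _ _ := rfl
  map_smul' _ _ := rfl
  left_inv _ := rfl
  right_inv _ := rfl

theorem finrank_formSpace : finrank ℂ (FormSpace hΦ) = u := by
  rw [(formEquiv hΦ).finrank_eq, finrank_fin_fun]

theorem formEquiv_formMap (M : Matrix (Fin e) (Fin u) ℂ) (x : FormSpace hΦ) :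
    formEquiv hΨ (formMap hΨ hΦ M x) = M *ᵥ formEquiv hΦ x := rfl

theorem formMap_sub_smul (M N : Matrix (Fin e) (Fin u) ℂ) (c : ℂ) :
    formMap hΨ hΦ (M - c • N) = formMap hΨ hΦ M - c • formMap hΨ hΦ N := by
  refine LinearMap.ext fun x => ?_
  apply (formEquiv hΨ).injective
  rw [LinearMap.sub_apply, LinearMap.smul_apply, map_sub, map_smul]
  simp only [formEquiv_formMap, Matrix.sub_mulVec, Matrix.smul_mulVec]

end FormSpaces

section SingularValueOrder

variable {𝕜 : Type*} [RCLike 𝕜] {d e u : ℕ} {𝔑 : Fin (d + 1) → Matrix (Fin e) (Fin u) 𝕜}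
  {n k : Fin (d + 1) → ℝ}

theorem norm_mul_exp_I_mul (ε θ : ℝ) : ‖(ε : ℂ) * Complex.exp (Complex.I * θ)‖ = |ε| := by
  rw [norm_mul, mul_comm Complex.I, Complex.norm_exp_ofReal_mul_I, mul_one, Complex.norm_real,
    Real.norm_eq_abs]

theorem IsHyperbolic.singularValuesOrderLeOne_iff (hyp : IsHyperbolic 𝔑 n)
    (hk : Transverse n k) {GΨ : Matrix (Fin e) (Fin e) ℂ} (hΨ : GΨ.PosDef)
    {GΦ : Matrix (Fin u) (Fin u) ℂ} (hΦ : GΦ.PosDef) :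
    SingularValuesOrderLeOne 𝔑 hΨ hΦ n k ↔
      HasNoChain (realSymbol 𝔑 n) (realSymbol 𝔑 k) := by
  simp only [SingularValuesOrderLeOne, singularValues, complexSymbol_extendedLine,
    formMap_sub_smul]
  constructor
  · intro h z φ ψ h1 h2
    by_contra hne
    have hz : ((z.re : ℝ) : ℂ) = z := Complex.ext (by simp) (by simp [hyp.im_eq_zero hk z φ hne h1])
    -- The direction θ = 0 alone already excludes chains; the converse treats all θ at once, using
    -- only that the shift has modulus |ε|.
    have h0 := h z.re 0 ⟨le_rfl, by positivity⟩
    simp only [Complex.ofReal_zero, mul_zero, Complex.exp_zero, mul_one, hz] at h0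
    obtain ⟨c, hc, hlow⟩ := exists_forall_le_norm_of_isTheta_singularValues fun j hj =>
      h0 j (by rwa [finrank_formSpace] at hj)
    refine hne ((formEquiv hΦ).symm.map_eq_zero_iff.1
      (eq_zero_of_forall_le_norm hc hlow (ψ := (formEquiv hΦ).symm ψ) ?_ ?_))
    · apply (formEquiv hΨ).injective
      rw [← formMap_sub_smul, formEquiv_formMap, LinearEquiv.apply_symm_apply, Matrix.sub_mulVec,
        Matrix.smul_mulVec, h1, sub_self, map_zero]
    · apply (formEquiv hΨ).injective
      rw [← formMap_sub_smul, formEquiv_formMap, formEquiv_formMap, LinearEquiv.apply_symm_apply,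
        LinearEquiv.apply_symm_apply, Matrix.sub_mulVec, Matrix.smul_mulVec, h2]
  · intro h z θ _ j hj
    obtain ⟨M, hM, hA⟩ := hyp.exists_hermitizable hk h
    obtain ⟨L, S, D, hL, hS, hSD⟩ := exists_leftInverse_of_diagonalizable hM hA.diagonalizable
    have hSd := (Matrix.isUnit_iff_isUnit_det _).1 hS
    have hS1 : S⁻¹ * S = 1 := Matrix.nonsing_inv_mul _ hSd
    have hS2 : S * S⁻¹ = 1 := Matrix.mul_nonsing_inv _ hSd
    -- Here L N = 1 and L K = S D S⁻¹, so G = S⁻¹ L turns N into Y = S⁻¹ and K into D Y.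
    let G : FormSpace hΨ →ₗ[ℂ] (Fin u → ℂ) := (S⁻¹ * L).mulVecLin ∘ₗ (formEquiv hΨ).toLinearMap
    let Y : FormSpace hΦ ≃ₗ[ℂ] (Fin u → ℂ) :=
      (formEquiv hΦ).trans (Matrix.toLin'OfInv hS2 hS1)
    have hG : ∀ x, G x = (S⁻¹ * L) *ᵥ formEquiv hΨ x := fun x => rfl
    have hY : ∀ x, Y x = S⁻¹ *ᵥ formEquiv hΦ x := fun x => rfl
    obtain ⟨c, hc, hlow⟩ := exists_forall_le_norm_of_diagonal (N := formMap hΨ hΦ (realSymbol 𝔑 n))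
      (K := formMap hΨ hΦ (realSymbol 𝔑 k)) G Y D
      (fun x => by
        rw [hG, hY, formEquiv_formMap, Matrix.mulVec_mulVec, Matrix.mul_assoc]
        rw [realSymbol, hL, Matrix.mul_one])
      (fun x => by
        rw [hG, hY, formEquiv_formMap, Matrix.mulVec_mulVec, Matrix.mul_assoc]
        rw [realSymbol, hSD, ← Matrix.mul_assoc, ← Matrix.mul_assoc, hS1, Matrix.one_mul,
          ← Matrix.mulVec_mulVec]
        funext i
        rw [Matrix.mulVec_diagonal, Pi.mul_apply])
      z (fun ε => norm_mul_exp_I_mul ε θ)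
    exact exists_isTheta_singularValues (fun ε => norm_mul_exp_I_mul ε θ) hc hlow
      (by rwa [finrank_formSpace])

end SingularValueOrder

end

end FirstOrderSystem

/-! ### The equivalences for one line and for all lines. -/

open FirstOrderSystem in
theorem mainTheorem3 {𝕜 : Type*} [RCLike 𝕜] {d e u : ℕ}
    (𝔑 : Fin (d + 1) → Matrix (Fin e) (Fin u) 𝕜) (n : Fin (d + 1) → ℝ)
    (hyp : IsHyperbolic 𝔑 n)
    (GΨ : Matrix (Fin e) (Fin e) ℂ) (hΨ : GΨ.PosDef)
    (GΦ : Matrix (Fin u) (Fin u) ℂ) (hΦ : GΦ.PosDef) :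
    (∀ k, Transverse n k →
      List.TFAE [
        ∃ h, IsReduction 𝔑 n h ∧ Diagonalizable (reducedMatrix 𝔑 n h k),
        ∃ h, IsReduction 𝔑 n h ∧ Hermitizable (reducedMatrix 𝔑 n h k),
        TrivialKronecker (fun z => complexSymbol 𝔑 (line n k z)),
        SingularValuesOrderLeOne 𝔑 hΨ hΦ n k,
        PerturbationCoefficientsPos 𝔑 GΨ GΦ n k]) ∧
    List.TFAE [
      ∃ h, IsReduction 𝔑 n h ∧ ∀ k, Transverse n k → Diagonalizable (reducedMatrix 𝔑 n h k),
      ∃ h, IsReduction 𝔑 n h ∧ ∀ k, Transverse n k → Hermitizable (reducedMatrix 𝔑 n h k),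
      ∀ k, Transverse n k → TrivialKronecker (fun z => complexSymbol 𝔑 (line n k z)),
      ∀ k, Transverse n k → SingularValuesOrderLeOne 𝔑 hΨ hΦ n k,
      ∀ k, Transverse n k → PerturbationCoefficientsPos 𝔑 GΨ GΦ n k] := by
  constructor
  · intro k hk
    rw [hyp.trivialKronecker_iff hk, hyp.singularValuesOrderLeOne_iff hk hΨ hΦ,
      hyp.perturbationCoefficientsPos_iff hk hΨ hΦ]
    tfae_have 1 → 3 := fun ⟨_, hh, hA⟩ => hasNoChain_of_diagonalizable hk hh hA
    tfae_have 2 → 1 := fun ⟨h, hh, hA⟩ => ⟨h, hh, hA.diagonalizable⟩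
    tfae_have 3 → 2 := fun h => by
      obtain ⟨M, hM, hA⟩ := hyp.exists_hermitizable hk h
      -- For a single k a constant reduction is enough, since invertibility of M N does not involve
      -- k.
      exact ⟨fun _ => M, ⟨fun _ _ => hM, fun _ _ _ _ => rfl⟩, hA⟩
    tfae_have 3 ↔ 4 := Iff.rfl
    tfae_have 4 ↔ 5 := Iff.rfl
    tfae_finish
  · rw [forall₂_congr fun k hk => hyp.trivialKronecker_iff (k := k) hk,
      forall₂_congr fun k hk => hyp.singularValuesOrderLeOne_iff (k := k) hk hΨ hΦ,
      forall₂_congr fun k hk => hyp.perturbationCoefficientsPos_iff (k := k) hk hΨ hΦ]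
    tfae_have 1 → 3 := fun ⟨_, hh, hA⟩ k hk => hasNoChain_of_diagonalizable hk hh (hA k hk)
    tfae_have 2 → 1 := fun ⟨h, hh, hA⟩ => ⟨h, hh, fun k hk => (hA k hk).diagonalizable⟩
    tfae_have 3 → 2 := fun h => exists_isReduction_forall_hermitizable fun k hk =>
      hyp.exists_hermitizable hk (h k hk)
    tfae_have 3 ↔ 4 := Iff.rfl
    tfae_have 4 ↔ 5 := Iff.rfl
    tfae_finish
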